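/- Let $\mathcal B$ be a real or complex Banach space that is either reflexive and separable, or a Hilbert space, and let $t>0$. A $C_0$-semigroup on $\mathcal B$ is a family $(T(s))_{s\ge 0}$ of bounded linear operators with $T(0)=I$, $T(l+m)=T(l)T(m)$ for $l,m\ge 0$, $s\mapsto T(s)x$ continuous on $[0,\infty)$ for every $x$, and $\|T(s)\|\le Me^{as}$ for some $M\ge 1$, $a\in\mathbb R$ and all $s\ge 0$; its generator is the operator $Zx=\lim_{h\to 0+}h^{-1}(T(h)x-x)$ whose domain consists of all $x$ for which the limit exists, and one writes $T(s)=e^{sZ}$. Let $C$ and $D$ be generators of $C_0$-semigroups $e^{sC}$ and $e^{sD}$ on $\mathcal B$, and let $C+D$ be defined on $\mathcal D(C)\cap\mathcal D(D)$. Assume: (i) $\mathcal D(C)\cap\mathcal D(D)$ is dense in $\mathcal B$; (ii) $\mathcal D(C^*)\cap\mathcal D(D^*)$ is dense in the dual space $\mathcal B^*$; (iii) there exist $a\in\mathbb R$ and $M\ge 1$ such that $$\Bigl\|\bigl(e^{\frac sn C}e^{\frac sn D}\bigr)^m\Bigr\|\le M e^{a s m/n}$$ for all positive integers $n,m$ and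 all $s>0$. Then $C+D$ is closable and its closure is the generator of a $C_0$-semigroup if and only if there exists a linear subspace $A\subseteq\mathcal D(C)\cap\mathcal D(D)$, dense in $\mathcal B$, such that for every $f\in A$ and every $s\ge 0$ there is a sequence $(f_n)_{n\ge 1}$ in $\mathcal D(C)\cap\mathcal D(D)$ satisfying (a) $\displaystyle\lim_{n\to\infty}\Bigl\|\bigl(e^{\frac tn C}e^{\frac tn D}\bigr)^{[ns]}f-f_n\Bigr\|=0$, where $[\cdot]$ is the integer part, and (b) $\bigl((C+D)f_n\bigr)_{n\ge 1}$ is a bounded sequence. Furthermore, if such an $A$ exists, then $$e^{s\,\overline{C+D}}f=\lim_{n\to\infty}\bigl(e^{\frac sn C}e^{\frac sn D}\bigr)^n f\qquad\text{for all } s>0,\ f\in\mathcal B.$$ -/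

import Mathlib

open Filter Topology
open scoped NNReal

section SemigroupDefs

variable {𝕜 B : Type*} [RCLike 𝕜] [NormedAddCommGroup B] [NormedSpace 𝕜 B]

/-- A `C₀`-semigroup of bounded linear operators on `B`, indexed by `[0, ∞)`; continuity is with
respect to the strong operator topology. -/
structure IsC0Semigroup (T : ℝ≥0 → B →L[𝕜] B) : Prop where
  map_zero : T 0 = 1
  map_add : ∀ l m : ℝ≥0, T (l + m) = T l * T m
  strongly_continuous : ∀ x : B, Continuous fun s : ℝ≥0 => T s x
  exp_bound : ∃ M a : ℝ, 1 ≤ M ∧ ∀ s : ℝ≥0, ‖T s‖ ≤ M * Real.exp (a * s)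

/-- `Z` is the strong derivative at `0` of `S : [0, ∞) → L(B)`: its graph consists exactly of the
pairs `(x, y)` with `y = lim_{h → 0+} h⁻¹ (S h x - S 0 x)`; in particular the domain of `Z` is the
set of all `x` for which this limit exists. -/
def IsStrongDerivAtZero (Z : B →ₗ.[𝕜] B) (S : ℝ≥0 → B →L[𝕜] B) : Prop :=
  ∀ x y : B, (x, y) ∈ Z.graph ↔
    Tendsto (fun h : ℝ≥0 => (((h : ℝ) : 𝕜))⁻¹ • (S h x - S 0 x)) (𝓝[>] 0) (𝓝 y)

/-- `T` is a `C₀`-semigroup and `Z` is its generator, so that `T s = exp (s Z)`. -/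
def IsC0Generator (Z : B →ₗ.[𝕜] B) (T : ℝ≥0 → B →L[𝕜] B) : Prop :=
  IsC0Semigroup T ∧ IsStrongDerivAtZero Z T

/-- The domain of the Banach space adjoint `Z*` of a densely defined operator `Z`: the functionals
`φ` for which `x ↦ φ (Z x)` extends to a continuous functional `ψ` on `B` (then `ψ = Z* φ`). -/
def dualAdjointDomain (Z : B →ₗ.[𝕜] B) : Set (StrongDual 𝕜 B) :=
  {φ | ∃ ψ : StrongDual 𝕜 B, ∀ x : Z.domain, φ (Z x) = ψ (x : B)}

variable (𝕜 B) in
/-- Reflexivity: the canonical embedding into the bidual is onto. -/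
def IsReflexiveSpace : Prop :=
  Function.Surjective (NormedSpace.inclusionInDoubleDual 𝕜 B)

variable (𝕜 B) in
/-- The given norm of `B` comes from an inner product over `𝕜` (for complete `B`: `B` is a Hilbert
space). -/
def HasInnerProduct : Prop :=
  ∃ i : InnerProductSpace 𝕜 B, i.toNormedSpace = (inferInstance : NormedSpace 𝕜 B)

/-- The Trotter step `s ↦ exp (s C) exp (s D)` built from two semigroups. -/
def trotterStep (S T : ℝ≥0 → B →L[𝕜] B) (s : ℝ≥0) : B →L[𝕜] B := S s * T s

/-- Stability of the Trotter products:
`‖(exp ((s/n) C) exp ((s/n) D)) ^ m‖ ≤ M exp (a s m / n)`. -/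
def TrotterStable (S T : ℝ≥0 → B →L[𝕜] B) : Prop :=
  ∃ a M : ℝ, 1 ≤ M ∧ ∀ n m : ℕ, 1 ≤ n → ∀ s : ℝ≥0, 0 < s →
    ‖trotterStep S T (s / n) ^ m‖ ≤ M * Real.exp (a * s * (m / n))

/-- The approximation condition for a linear operator `Z` and `F : [0, ∞) → L(B)` at the parameter
`t`: there is a dense linear subspace `A` of the domain of `Z` such that for all `f ∈ A` and
`s ≥ 0` there are `u n` in the domain of `Z` with `‖F (t/n) ^ [n s] f - u n‖ → 0` and `Z (u n)`
bounded. -/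
def BoundedApproximation (Z : B →ₗ.[𝕜] B) (F : ℝ≥0 → B →L[𝕜] B) (t : ℝ≥0) : Prop :=
  ∃ A : Submodule 𝕜 B, A ≤ Z.domain ∧ Dense (A : Set B) ∧
    ∀ f ∈ A, ∀ s : ℝ≥0, ∃ u : ℕ → Z.domain,
      Tendsto (fun n : ℕ => ‖(F (t / n) ^ ⌊(n : ℝ≥0) * s⌋₊) f - (u n : B)‖) atTop (𝓝 0) ∧
      ∃ K : ℝ, ∀ n : ℕ, ‖Z (u n)‖ ≤ K

end SemigroupDefs

section SemigroupBasics

variable {𝕜 B : Type*} [RCLike 𝕜] [NormedAddCommGroup B] [NormedSpace 𝕜 B]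
  {Z : B →ₗ.[𝕜] B} {T : ℝ≥0 → B →L[𝕜] B}

theorem IsC0Semigroup.exists_norm_le (hT : IsC0Semigroup T) (S : ℝ≥0) :
    ∃ K : ℝ, 1 ≤ K ∧ ∀ s ≤ S, ‖T s‖ ≤ K := by
  obtain ⟨M, a, hM, h⟩ := hT.exp_bound
  refine ⟨M * Real.exp (|a| * S), ?_, fun s hs => (h s).trans ?_⟩
  · have : 1 ≤ Real.exp (|a| * S) := Real.one_le_exp (by positivity)
    nlinarith
  · have h1 : a * s ≤ |a| * S :=
      mul_le_mul (le_abs_self a) (by exact_mod_cast hs) s.2 (abs_nonneg a)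
    gcongr

theorem IsC0Semigroup.hasDerivWithinAt_dual (hT : IsC0Semigroup T) (φ : StrongDual 𝕜 B) {x y : B}
    (h1 : Tendsto (fun h : ℝ≥0 => (((h : ℝ) : 𝕜))⁻¹ • (T h x - T 0 x)) (𝓝[>] 0) (𝓝 y))
    {s : ℝ} (hs : 0 ≤ s) :
    HasDerivWithinAt (fun σ : ℝ => φ (T σ.toNNReal x)) (φ (T s.toNNReal y)) (Set.Ici s) s := by
  rw [← hasDerivWithinAt_Ioi_iff_Ici, hasDerivWithinAt_iff_tendsto_slope' (by simp)]
  have h2 : Tendsto (fun b : ℝ => (b - s).toNNReal) (𝓝[>] s) (𝓝[>] 0) := by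
    refine tendsto_nhdsWithin_iff.2 ⟨?_, ?_⟩
    · have : Continuous fun b : ℝ => (b - s).toNNReal := by fun_prop
      have h := this.tendsto s
      simp only [sub_self, Real.toNNReal_zero] at h
      exact h.mono_left nhdsWithin_le_nhds
    · filter_upwards [self_mem_nhdsWithin] with b hb
      simpa using hb
  have h3 := ((φ.comp (T s.toNNReal)).continuous.tendsto y).comp (h1.comp h2)
  refine h3.congr' ?_
  filter_upwards [self_mem_nhdsWithin] with b hb
  have hb' : s < b := hb
  have hadd : b.toNNReal = s.toNNReal + (b - s).toNNReal := by
    rw [← Real.toNNReal_add hs (by linarith)]; congr 1; ring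
  simp only [Function.comp_apply, slope, vsub_eq_sub, hadd, hT.map_add, hT.map_zero,
    ContinuousLinearMap.comp_apply, map_smul, map_sub, mul_apply_eq_comp,
    one_apply_eq_self, RCLike.real_smul_eq_coe_mul, smul_eq_mul]
  rw [Real.coe_toNNReal _ (by linarith : (0:ℝ) ≤ b - s)]
  push_cast
  rfl

theorem IsC0Semigroup.continuous_dual (hT : IsC0Semigroup T) (φ : StrongDual 𝕜 B) (x : B) :
    Continuous fun σ : ℝ => φ (T σ.toNNReal x) :=
  φ.continuous.comp ((hT.strongly_continuous x).comp continuous_real_toNNReal)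

theorem IsC0Generator.norm_dual_sub_le (hZ : IsC0Generator Z T) (φ : StrongDual 𝕜 B)
    {x y : B} (hxy : (x, y) ∈ Z.graph) (c : 𝕜) (δ : ℝ) (h : ℝ≥0)
    (hδ : ∀ σ ≤ h, ‖φ (T σ y) - c‖ ≤ δ) :
    ‖φ (T h x) - φ x - ((h : ℝ) : 𝕜) * c‖ ≤ δ * h := by
  have key := norm_image_sub_le_of_norm_deriv_right_le_segment
    (f := fun σ : ℝ => φ (T σ.toNNReal x) - σ • c) (f' := fun σ => φ (T σ.toNNReal y) - c)
    (a := 0) (b := h) (C := δ)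
    (((hZ.1.continuous_dual φ x).sub (by fun_prop)).continuousOn)
    (fun σ hσ => by
      have := (hZ.1.hasDerivWithinAt_dual φ ((hZ.2 x y).1 hxy) hσ.1).sub
        (((hasDerivAt_id σ).smul_const c).hasDerivWithinAt (s := Set.Ici σ))
      rw [one_smul] at this
      exact this)
    (fun σ hσ => hδ _ (by rw [Real.toNNReal_le_iff_le_coe]; exact hσ.2.le))
    h ⟨h.2, le_rfl⟩
  simp only [Real.toNNReal_coe, Real.toNNReal_zero, hZ.1.map_zero, zero_smul, sub_zero,
    one_apply_eq_self, RCLike.real_smul_eq_coe_mul] at key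
  rwa [sub_right_comm]

/-- A solution of the eigenvalue equation for a functional grows exponentially. -/
theorem IsC0Semigroup.dual_eq_exp_mul (hT : IsC0Semigroup T) (φ : StrongDual 𝕜 B) (r : ℝ) {x y : B}
    (hxy : Tendsto (fun h : ℝ≥0 => (((h : ℝ) : 𝕜))⁻¹ • (T h x - T 0 x)) (𝓝[>] 0) (𝓝 y))
    (h : ∀ s, φ (T s y) = (r : 𝕜) * φ (T s x)) (s : ℝ≥0) :
    φ (T s x) = (Real.exp (r * s) : ℝ) * φ x := by
  have key := constant_of_has_deriv_right_zero
    (f := fun σ : ℝ => Real.exp (-(r * σ)) • φ (T σ.toNNReal x)) (a := 0) (b := s)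
    (((by fun_prop : Continuous fun σ : ℝ => Real.exp (-(r * σ))).smul
      (hT.continuous_dual φ x)).continuousOn)
    (fun σ hσ => by
      have h1 : HasDerivAt (fun σ : ℝ => Real.exp (-(r * σ))) (Real.exp (-(r * σ)) * (-r)) σ := by
        have := (((hasDerivAt_id σ).const_mul r).neg).exp
        simpa using this
      have := (h1.hasDerivWithinAt (s := Set.Ici σ)).smul (hT.hasDerivWithinAt_dual φ hxy hσ.1)
      refine HasDerivWithinAt.congr_deriv this ?_
      rw [h]
      simp only [RCLike.real_smul_eq_coe_mul]
      push_cast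
      ring)
    s ⟨s.2, le_rfl⟩
  simp only [Real.toNNReal_coe, Real.toNNReal_zero, hT.map_zero, mul_zero, neg_zero,
    Real.exp_zero, one_smul, one_apply_eq_self] at key
  rw [← key, RCLike.real_smul_eq_coe_mul, ← mul_assoc, ← RCLike.ofReal_mul, ← Real.exp_add]
  simp

theorem IsC0Semigroup.dual_eq_zero_of_eigen (hT : IsC0Semigroup T) {M a r : ℝ} (har : a < r)
    (hM : ∀ s : ℝ≥0, ‖T s‖ ≤ M * Real.exp (a * s)) (φ : StrongDual 𝕜 B) {x y : B}
    (hxy : Tendsto (fun h : ℝ≥0 => (((h : ℝ) : 𝕜))⁻¹ • (T h x - T 0 x)) (𝓝[>] 0) (𝓝 y))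
    (h : ∀ s, φ (T s y) = (r : 𝕜) * φ (T s x)) : φ x = 0 := by
  have hb : ∀ s : ℝ≥0, ‖φ x‖ ≤ ‖φ‖ * (M * ‖x‖) * Real.exp ((a - r) * s) := fun s => by
    have h1 := congrArg norm (hT.dual_eq_exp_mul φ r hxy h s)
    rw [norm_mul, RCLike.norm_ofReal, abs_of_pos (Real.exp_pos _)] at h1
    have h2 : ‖φ (T s x)‖ ≤ ‖φ‖ * (M * Real.exp (a * s) * ‖x‖) :=
      φ.le_opNorm_of_le ((T s).le_of_opNorm_le (hM s) x)
    rw [h1, ← le_div_iff₀' (Real.exp_pos _)] at h2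
    refine h2.trans (le_of_eq ?_)
    rw [sub_mul, Real.exp_sub]
    ring
  have hlim : Tendsto (fun s : ℝ≥0 => ‖φ‖ * (M * ‖x‖) * Real.exp ((a - r) * s)) atTop (𝓝 0) := by
    have h1 : Tendsto (fun s : ℝ≥0 => (a - r) * (s : ℝ)) atTop atBot :=
      (NNReal.tendsto_coe_atTop.2 tendsto_id).const_mul_atTop_of_neg (by linarith)
    simpa using (Real.tendsto_exp_atBot.comp h1).const_mul (‖φ‖ * (M * ‖x‖))
  exact norm_le_zero_iff.1 (ge_of_tendsto' hlim hb)

theorem norm_apply_le_of_dense {E : Submodule 𝕜 B} (hE : Dense (E : Set B)) (φ : StrongDual 𝕜 B)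
    {C : ℝ} (h : ∀ x ∈ E, ‖φ x‖ ≤ C * ‖x‖) (hC : 0 ≤ C) : ‖φ‖ ≤ C := by
  refine φ.opNorm_le_bound hC fun x => ?_
  exact isClosed_property (p := fun x => ‖φ x‖ ≤ C * ‖x‖) hE.denseRange_val
    (isClosed_le (by fun_prop) (by fun_prop)) (fun x => h x x.2) x

theorem IsC0Generator.map_mem_graph (hZ : IsC0Generator Z T) {x y : B} (hxy : (x, y) ∈ Z.graph)
    (σ : ℝ≥0) : (T σ x, T σ y) ∈ Z.graph := by
  rw [hZ.2]
  have := ((T σ).continuous.tendsto y).comp ((hZ.2 x y).1 hxy)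
  refine this.congr fun h => ?_
  have : T h * T σ = T σ * T h := by rw [← hZ.1.map_add, ← hZ.1.map_add, add_comm]
  have h2 : T h (T σ x) = T σ (T h x) := congrArg (fun A : B →L[𝕜] B => A x) this
  simp [hZ.1.map_zero, h2]

theorem IsC0Generator.norm_dual_comp_sub_le (hZ : IsC0Generator Z T)
    (hd : Dense (Z.domain : Set B)) {φ ψ : StrongDual 𝕜 B}
    (hφ : ∀ x y, (x, y) ∈ Z.graph → φ y = ψ x) {δ : ℝ} (h : ℝ≥0)
    (c : StrongDual 𝕜 B) (hδ : ∀ σ ≤ h, ‖ψ.comp (T σ) - c‖ ≤ δ) :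
    ‖φ.comp (T h) - φ - ((h : ℝ) : 𝕜) • c‖ ≤ δ * h := by
  have hδ0 : 0 ≤ δ := (norm_nonneg _).trans (hδ 0 zero_le)
  refine norm_apply_le_of_dense hd _ (fun x hx => ?_) (by positivity)
  obtain ⟨y, hxy⟩ := LinearPMap.mem_domain_iff.1 hx
  have := hZ.norm_dual_sub_le φ hxy (c x) (δ * ‖x‖) h (fun σ hσ => ?_)
  · simp only [sub_apply, ContinuousLinearMap.comp_apply,
      smul_apply, smul_eq_mul]
    linarith
  · rw [hφ _ _ (hZ.map_mem_graph hxy σ)]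
    have := (ψ.comp (T σ) - c).le_of_opNorm_le (hδ σ hσ) x
    simpa using this

theorem mem_dualAdjointDomain_iff {φ : StrongDual 𝕜 B} :
    φ ∈ dualAdjointDomain Z ↔ ∃ ψ : StrongDual 𝕜 B, ∀ x y, (x, y) ∈ Z.graph → φ y = ψ x := by
  refine ⟨fun ⟨ψ, h⟩ => ⟨ψ, fun x y hxy => ?_⟩, fun ⟨ψ, h⟩ => ⟨ψ, fun x => ?_⟩⟩
  · obtain ⟨x', rfl, rfl⟩ := (LinearPMap.mem_graph_iff Z).1 hxy
    exact h x'
  · exact h _ _ (Z.mem_graph x)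

/-- If the adjoint of the generator is densely defined, the adjoint semigroup is strongly
continuous at `0`. -/
theorem IsC0Generator.tendsto_dual_comp (hZ : IsC0Generator Z T)
    (hd : Dense (Z.domain : Set B)) (hd' : Dense (dualAdjointDomain Z)) (ψ : StrongDual 𝕜 B) :
    Tendsto (fun h : ℝ≥0 => ψ.comp (T h)) (𝓝 0) (𝓝 ψ) := by
  obtain ⟨K, hK, hTK⟩ := hZ.1.exists_norm_le 1
  rw [Metric.tendsto_nhds]
  intro ε hε
  obtain ⟨φ, hφ, hφd⟩ := Metric.dense_iff.1 hd' ψ (ε / (2 * (K + 1))) (by positivity)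
  obtain ⟨η, hη⟩ := mem_dualAdjointDomain_iff.1 hφd
  have hsmall : Tendsto (fun h : ℝ≥0 => ‖η‖ * K * (h : ℝ)) (𝓝 0) (𝓝 0) := by
    have : Continuous fun h : ℝ≥0 => ‖η‖ * K * (h : ℝ) := by fun_prop
    simpa using this.tendsto 0
  filter_upwards [hsmall.eventually_lt_const (half_pos hε),
    Iic_mem_nhds (zero_lt_one : (0 : ℝ≥0) < 1)] with h hh h1
  have hb := hZ.norm_dual_comp_sub_le hd hη h 0 (δ := ‖η‖ * K) (fun σ hσ => by
    rw [sub_zero]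
    exact (ContinuousLinearMap.opNorm_comp_le _ _).trans
      (mul_le_mul_of_nonneg_left (hTK σ (hσ.trans h1)) (norm_nonneg _)))
  have e0 : φ.comp (T h) - φ - ((h : ℝ) : 𝕜) • (0 : StrongDual 𝕜 B) = φ.comp (T h) - φ := by
    ext x; simp
  rw [e0] at hb
  have hdist : ‖ψ - φ‖ < ε / (2 * (K + 1)) := by
    rw [Metric.mem_ball, dist_comm, dist_eq_norm] at hφ; exact hφ
  rw [dist_eq_norm]
  have e : ψ.comp (T h) - ψ = (ψ - φ).comp (T h) + (φ.comp (T h) - φ) - (ψ - φ) := by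
    ext x; simp
  rw [e]
  have h2 : ‖(ψ - φ).comp (T h)‖ ≤ ‖ψ - φ‖ * K :=
    (ContinuousLinearMap.opNorm_comp_le _ _).trans
      (mul_le_mul_of_nonneg_left (hTK h h1) (norm_nonneg _))
  have h3 : ‖ψ - φ‖ * (K + 1) < ε / 2 := by
    calc _ < ε / (2 * (K + 1)) * (K + 1) := by gcongr
      _ = ε / 2 := by field_simp
  calc _ ≤ ‖(ψ - φ).comp (T h)‖ + ‖φ.comp (T h) - φ‖ + ‖ψ - φ‖ :=
        (norm_sub_le _ _).trans (by gcongr; exact norm_add_le _ _)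
    _ < ε := by linarith

theorem IsC0Generator.tendsto_dual_slope (hZ : IsC0Generator Z T)
    (hd : Dense (Z.domain : Set B)) (hd' : Dense (dualAdjointDomain Z)) {φ ψ : StrongDual 𝕜 B}
    (hφ : ∀ x y, (x, y) ∈ Z.graph → φ y = ψ x) :
    Tendsto (fun h : ℝ≥0 => (((h : ℝ) : 𝕜))⁻¹ • (φ.comp (T h) - φ)) (𝓝[>] 0) (𝓝 ψ) := by
  rw [Metric.tendsto_nhds]
  intro ε hε
  have h1 := (Metric.tendsto_nhds.1 (hZ.tendsto_dual_comp hd hd' ψ)) (ε / 2) (half_pos hε)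
  obtain ⟨δ, hδ, hball⟩ := Metric.eventually_nhds_iff.1 h1
  filter_upwards [self_mem_nhdsWithin, nhdsWithin_le_nhds (Metric.ball_mem_nhds 0 hδ)] with h h0 hh
  have h0' : (0 : ℝ) < h := h0
  have hb := hZ.norm_dual_comp_sub_le hd hφ h ψ (δ := ε / 2) (fun σ hσ => by
    rw [← dist_eq_norm]
    refine (hball (lt_of_le_of_lt ?_ hh)).le
    simp only [NNReal.dist_eq, NNReal.coe_zero, sub_zero, NNReal.abs_eq]
    exact_mod_cast hσ)
  have h𝕜 : ((h : ℝ) : 𝕜) ≠ 0 := by exact_mod_cast h0'.ne'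
  have e : (((h : ℝ) : 𝕜))⁻¹ • (φ.comp (T h) - φ) - ψ
      = (((h : ℝ) : 𝕜))⁻¹ • (φ.comp (T h) - φ - ((h : ℝ) : 𝕜) • ψ) := by
    rw [smul_sub _ _ (((h : ℝ) : 𝕜) • ψ), smul_smul, inv_mul_cancel₀ h𝕜, one_smul]
  rw [dist_eq_norm, e, norm_smul, norm_inv, RCLike.norm_ofReal, abs_of_pos h0']
  calc _ ≤ (h : ℝ)⁻¹ * (ε / 2 * h) := by gcongr
    _ = ε / 2 := by field_simp
    _ < ε := half_lt_self hε

end SemigroupBasics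

section StrongLimits

variable {𝕜 B : Type*} [RCLike 𝕜] [NormedAddCommGroup B] [NormedSpace 𝕜 B]

theorem tendsto_zero_of_dense {E : Type*} [NormedAddCommGroup E] [NormedSpace 𝕜 E]
    {Q : ℕ → B →L[𝕜] E} {K : ℝ} (hQ : ∀ n, ‖Q n‖ ≤ K) {S : Set B}
    (hS : Dense S) (h : ∀ z ∈ S, Tendsto (fun n => Q n z) atTop (𝓝 0)) (z : B) :
    Tendsto (fun n => Q n z) atTop (𝓝 0) := by
  have hK : 0 ≤ K := (norm_nonneg _).trans (hQ 0)
  rw [Metric.tendsto_nhds]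
  intro ε hε
  obtain ⟨y, hy, hyS⟩ := Metric.dense_iff.1 hS z (ε / (2 * (K + 1))) (by positivity)
  filter_upwards [Metric.tendsto_nhds.1 (h y hyS) (ε / 2) (half_pos hε)] with n hn
  rw [dist_zero_right] at hn ⊢
  have hzy : ‖z - y‖ < ε / (2 * (K + 1)) := by
    rw [Metric.mem_ball, dist_comm, dist_eq_norm] at hy; exact hy
  have h1 : ‖Q n (z - y)‖ ≤ K * ‖z - y‖ := (Q n).le_of_opNorm_le (hQ n) _
  have h2 : (K + 1) * ‖z - y‖ < ε / 2 := by
    calc _ < (K + 1) * (ε / (2 * (K + 1))) := by gcongr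
      _ = ε / 2 := by field_simp
  calc ‖Q n z‖ = ‖Q n (z - y) + Q n y‖ := by rw [← map_add]; simp
    _ ≤ ‖Q n (z - y)‖ + ‖Q n y‖ := norm_add_le _ _
    _ < ε := by nlinarith [norm_nonneg (z - y)]

theorem tendsto_of_dense {Q : ℕ → B →L[𝕜] B} {J : B →L[𝕜] B} {K : ℝ} (hQ : ∀ n, ‖Q n‖ ≤ K)
    {S : Set B} (hS : Dense S) (h : ∀ z ∈ S, Tendsto (fun n => Q n z) atTop (𝓝 (J z))) (z : B) :
    Tendsto (fun n => Q n z) atTop (𝓝 (J z)) := by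
  have := tendsto_zero_of_dense (Q := fun n => Q n - J) (K := K + ‖J‖)
    (fun n => (norm_sub_le _ _).trans (by gcongr; exact hQ n)) hS
    (fun z hz => by simpa using (h z hz).sub_const (J z)) z
  simpa using this.add_const (J z)

theorem exists_strong_limit [CompleteSpace B] {Q : ℕ → B →L[𝕜] B} {K : ℝ} (hQ : ∀ n, ‖Q n‖ ≤ K)
    {S : Set B} (hS : Dense S) (h : ∀ z ∈ S, CauchySeq (fun n => Q n z)) :
    ∃ J : B →L[𝕜] B, ∀ z, Tendsto (fun n => Q n z) atTop (𝓝 (J z)) := by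
  have hK : 0 ≤ K := (norm_nonneg _).trans (hQ 0)
  have hc : ∀ z, CauchySeq (fun n => Q n z) := by
    intro z
    rw [Metric.cauchySeq_iff]
    intro ε hε
    obtain ⟨y, hy, hyS⟩ := Metric.dense_iff.1 hS z (ε / (4 * (K + 1))) (by positivity)
    obtain ⟨N, hN⟩ := Metric.cauchySeq_iff.1 (h y hyS) (ε / 2) (half_pos hε)
    refine ⟨N, fun m hm n hn => ?_⟩
    have hzy : ‖z - y‖ < ε / (4 * (K + 1)) := by
      rw [Metric.mem_ball, dist_comm, dist_eq_norm] at hy; exact hy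
    have h1 : ∀ n, ‖Q n (z - y)‖ ≤ K * ‖z - y‖ := fun n => (Q n).le_of_opNorm_le (hQ n) _
    have h2 : (K + 1) * ‖z - y‖ < ε / 4 := by
      calc _ < (K + 1) * (ε / (4 * (K + 1))) := by gcongr
        _ = ε / 4 := by field_simp
    have h3 := hN m hm n hn
    rw [dist_eq_norm] at h3 ⊢
    have e : Q m z - Q n z = Q m (z - y) - Q n (z - y) + (Q m y - Q n y) := by
      simp only [map_sub]; abel
    calc ‖Q m z - Q n z‖ ≤ ‖Q m (z - y)‖ + ‖Q n (z - y)‖ + ‖Q m y - Q n y‖ := by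
          rw [e]; exact (norm_add_le _ _).trans (by gcongr; exact norm_sub_le _ _)
      _ < ε := by nlinarith [norm_nonneg (z - y), h1 m, h1 n]
  choose g hg using fun z => cauchySeq_tendsto_of_complete (hc z)
  exact ⟨continuousLinearMapOfTendsto Q (tendsto_pi_nhds.2 hg), fun z => hg z⟩

theorem tendsto_apply_of_strong {Q : ℕ → B →L[𝕜] B} {J : B →L[𝕜] B} {K : ℝ}
    (hQ : ∀ n, ‖Q n‖ ≤ K) (h : ∀ z, Tendsto (fun n => Q n z) atTop (𝓝 (J z))) {u : ℕ → B} {z : B}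
    (hu : Tendsto u atTop (𝓝 z)) : Tendsto (fun n => Q n (u n)) atTop (𝓝 (J z)) := by
  have h1 : Tendsto (fun n => Q n (u n - z)) atTop (𝓝 0) := by
    refine squeeze_zero_norm (fun n => (Q n).le_of_opNorm_le (hQ n) _) ?_
    have := (tendsto_iff_norm_sub_tendsto_zero.1 hu).const_mul K
    simpa using this
  have := h1.add (h z)
  simpa using this

theorem norm_le_of_strong {Q : ℕ → B →L[𝕜] B} {J : B →L[𝕜] B} {K : ℝ}
    (hQ : ∀ n, ‖Q n‖ ≤ K) (h : ∀ z, Tendsto (fun n => Q n z) atTop (𝓝 (J z))) : ‖J‖ ≤ K := by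
  refine J.opNorm_le_bound ((norm_nonneg _).trans (hQ 0)) fun z => ?_
  exact le_of_tendsto (h z).norm (Eventually.of_forall fun n => (Q n).le_of_opNorm_le (hQ n) z)

theorem tendsto_pow_apply_of_strong {Q : ℕ → B →L[𝕜] B} {J : B →L[𝕜] B} {K : ℝ}
    (hQ : ∀ n, ‖Q n‖ ≤ K) (h : ∀ z, Tendsto (fun n => Q n z) atTop (𝓝 (J z))) (k : ℕ) (z : B) :
    Tendsto (fun n => (Q n ^ k) z) atTop (𝓝 ((J ^ k) z)) := by
  induction k with
  | zero => simp
  | succ k ih =>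
    simp only [pow_succ', mul_apply_eq_comp]
    exact tendsto_apply_of_strong hQ h ih

end StrongLimits

section Resolvents

variable {𝕜 B : Type*} [RCLike 𝕜] [NormedAddCommGroup B] [NormedSpace 𝕜 B]

/-- The difference quotient `h⁻¹ (L - 1)`. -/
noncomputable def diffQuot (L : B →L[𝕜] B) (h : ℝ) : B →L[𝕜] B := (h : 𝕜)⁻¹ • (L - 1)

theorem diffQuot_apply (L : B →L[𝕜] B) (h : ℝ) (x : B) :
    diffQuot L h x = (h : 𝕜)⁻¹ • (L x - x) := rfl

/-- `R` is the resolvent at `r` of the bounded operator `A`. -/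
structure IsResolventAt (A R : B →L[𝕜] B) (r : ℝ) : Prop where
  left_inv : ∀ x, R ((r : 𝕜) • x - A x) = x
  right_inv : ∀ x, (r : 𝕜) • R x - A (R x) = x

theorem norm_resolvent_pow_le {L R : B →L[𝕜] B} {h M ω r : ℝ} (hh : 0 < h) (hω : 0 ≤ ω)
    (hr : ω < r) (hL : ∀ k, ‖L ^ k‖ ≤ M * (1 + ω * h) ^ k)
    (hR : IsResolventAt (diffQuot L h) R r) (k : ℕ) : ‖R ^ k‖ ≤ M * ((r - ω)⁻¹) ^ k := by
  have hpos : 0 < 1 + ω * h := by positivity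
  have hM : 0 ≤ M := by have := (norm_nonneg _).trans (hL 0); simpa using this
  set a : B → ℕ → ℝ := fun x j => ‖(L ^ j) x‖ * ((1 + ω * h)⁻¹) ^ j with ha
  have hbound : ∀ x j, a x j ≤ M * ‖x‖ := fun x j => by
    have h1 := (L ^ j).le_of_opNorm_le (hL j) x
    calc a x j ≤ (M * (1 + ω * h) ^ j * ‖x‖) * ((1 + ω * h)⁻¹) ^ j := by
          simp only [ha]; gcongr
      _ = M * ‖x‖ := by rw [inv_pow]; field_simp
  have hbdd : ∀ x, BddAbove (Set.range (a x)) := fun x =>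
    ⟨M * ‖x‖, by rintro _ ⟨j, rfl⟩; exact hbound x j⟩
  have hle : ∀ x j, a x j ≤ ⨆ i, a x i := fun x j => le_ciSup (hbdd x) j
  have hnorm : ∀ x, ‖x‖ ≤ ⨆ i, a x i := fun x => by simpa [ha] using hle x 0
  have hcontr : ∀ x, (r - ω) * (⨆ i, a (R x) i) ≤ ⨆ i, a x i := by
    intro x
    have hrec : ∀ j, (1 + r * h) * a (R x) j ≤
        h * (⨆ i, a x i) + (1 + ω * h) * ⨆ i, a (R x) i := by
      intro j
      have h𝕜 : (h : 𝕜) ≠ 0 := by exact_mod_cast hh.ne'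
      have e1 : ((1 + r * h : ℝ) : 𝕜) • R x = (h : 𝕜) • x + L (R x) := by
        have h1 : (r : 𝕜) • R x - (h : 𝕜)⁻¹ • (L (R x) - R x) = x := hR.right_inv x
        have h2 : (h : 𝕜) • x = (h : 𝕜) • (r : 𝕜) • R x - (L (R x) - R x) := by
          nth_rewrite 1 [← h1]
          rw [smul_sub, smul_smul _ (h : 𝕜)⁻¹, mul_inv_cancel₀ h𝕜, one_smul]
        rw [h2]
        push_cast
        module
      have e2 := congrArg (fun y => ‖(L ^ j) y‖) e1
      rw [map_smul, norm_smul, RCLike.norm_ofReal, map_add, map_smul] at e2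
      rw [abs_of_pos (by nlinarith : 0 < 1 + r * h)] at e2
      have e3 : ‖(h : 𝕜) • (L ^ j) x + (L ^ j) (L (R x))‖ ≤
          h * ‖(L ^ j) x‖ + ‖(L ^ (j + 1)) (R x)‖ := by
        refine (norm_add_le _ _).trans (le_of_eq ?_)
        rw [norm_smul, RCLike.norm_ofReal, abs_of_pos hh, pow_succ, mul_apply_eq_comp]
      calc (1 + r * h) * a (R x) j
          = ((1 + r * h) * ‖(L ^ j) (R x)‖) * ((1 + ω * h)⁻¹) ^ j := by simp only [ha]; ring
        _ ≤ (h * ‖(L ^ j) x‖ + ‖(L ^ (j + 1)) (R x)‖) * ((1 + ω * h)⁻¹) ^ j := by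
            rw [e2]; gcongr
        _ = h * a x j + (1 + ω * h) * a (R x) (j + 1) := by
            simp only [ha, pow_succ]; field_simp
        _ ≤ _ := by gcongr <;> apply hle
    have hsup : (⨆ i, a (R x) i) ≤
        (h * (⨆ i, a x i) + (1 + ω * h) * ⨆ i, a (R x) i) / (1 + r * h) :=
      ciSup_le fun j => by
        rw [le_div_iff₀ (by nlinarith), mul_comm]; exact hrec j
    rw [le_div_iff₀ (by nlinarith)] at hsup
    have : h * ((r - ω) * (⨆ i, a (R x) i)) ≤ h * (⨆ i, a x i) := by nlinarith
    exact le_of_mul_le_mul_left this hh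
  have hiter : ∀ k x, (⨆ i, a ((R ^ k) x) i) ≤ ((r - ω)⁻¹) ^ k * ⨆ i, a x i := by
    intro k
    induction k with
    | zero => simp
    | succ k ih =>
      intro x
      rw [pow_succ, mul_apply_eq_comp]
      refine (ih (R x)).trans ?_
      rw [pow_succ, mul_assoc]
      refine mul_le_mul_of_nonneg_left ?_ (by have := sub_pos.2 hr; positivity)
      rw [inv_mul_eq_div, le_div_iff₀ (sub_pos.2 hr), mul_comm]
      exact hcontr x
  have hpow : 0 ≤ ((r - ω)⁻¹) ^ k := by have := sub_pos.2 hr; positivity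
  refine (R ^ k).opNorm_le_bound (by positivity) fun x => ?_
  calc ‖(R ^ k) x‖ ≤ _ := hnorm _
    _ ≤ _ := hiter k x
    _ ≤ ((r - ω)⁻¹) ^ k * (M * ‖x‖) := by gcongr; exact ciSup_le (hbound x)
    _ = _ := by ring

theorem exists_resolvent_diffQuot [CompleteSpace B] {L : B →L[𝕜] B} {h M ω r : ℝ} (hh : 0 < h)
    (hω : 0 ≤ ω) (hr : ω < r) (hL : ∀ k, ‖L ^ k‖ ≤ M * (1 + ω * h) ^ k) :
    ∃ R : B →L[𝕜] B, IsResolventAt (diffQuot L h) R r := by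
  have hpos : 0 < 1 + ω * h := by positivity
  have hpos' : 0 < 1 + r * h := by nlinarith
  have h𝕜 : (h : 𝕜) ≠ 0 := by exact_mod_cast hh.ne'
  have hq : ((1 + r * h : ℝ) : 𝕜) ≠ 0 := by exact_mod_cast hpos'.ne'
  set X : B →L[𝕜] B := ((1 + r * h : ℝ) : 𝕜)⁻¹ • L with hX
  have hsum : Summable (fun k : ℕ => X ^ k) := by
    refine Summable.of_norm_bounded (g := fun k => M * ((1 + ω * h) / (1 + r * h)) ^ k)
      ((summable_geometric_of_lt_one (by positivity) ?_).mul_left M) fun k => ?_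
    · rw [div_lt_one hpos']; nlinarith
    · rw [hX, smul_pow, norm_smul, norm_pow, norm_inv, RCLike.norm_ofReal, abs_of_pos hpos',
        div_pow]
      calc _ ≤ ((1 + r * h)⁻¹) ^ k * (M * (1 + ω * h) ^ k) := by gcongr; exact hL k
        _ = _ := by rw [inv_pow]; field_simp
  have h1 := hsum.tsum_pow_mul_one_sub
  have h2 := hsum.one_sub_mul_tsum_pow
  set S := ∑' k, X ^ k
  have eA : ∀ x, (r : 𝕜) • x - diffQuot L h x
      = ((h : 𝕜)⁻¹ * ((1 + r * h : ℝ) : 𝕜)) • (1 - X) x := by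
    intro x
    simp only [diffQuot_apply, hX, sub_apply, one_apply_eq_self, smul_apply, smul_sub, smul_smul]
    rw [mul_assoc, mul_inv_cancel₀ hq, mul_one]
    have : (h : 𝕜)⁻¹ * ((1 + r * h : ℝ) : 𝕜) = (h : 𝕜)⁻¹ + r := by
      push_cast; field_simp
    rw [this]
    module
  refine ⟨((h : 𝕜) * ((1 + r * h : ℝ) : 𝕜)⁻¹) • S, fun x => ?_, fun x => ?_⟩
  · rw [eA]
    have := congrArg (fun A : B →L[𝕜] B => A x) h1
    simp only [mul_apply_eq_comp, one_apply_eq_self] at this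
    rw [map_smul, smul_apply, this, smul_smul]
    rw [show (h : 𝕜)⁻¹ * ((1 + r * h : ℝ) : 𝕜) * ((h : 𝕜) * ((1 + r * h : ℝ) : 𝕜)⁻¹) = 1 by
      field_simp, one_smul]
  · rw [eA]
    have := congrArg (fun A : B →L[𝕜] B => A x) h2
    simp only [mul_apply_eq_comp, one_apply_eq_self] at this
    rw [smul_apply, map_smul, this, smul_smul]
    rw [show (h : 𝕜)⁻¹ * ((1 + r * h : ℝ) : 𝕜) * ((h : 𝕜) * ((1 + r * h : ℝ) : 𝕜)⁻¹) = 1 by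
      field_simp, one_smul]

/-- The resolvents of difference quotients converging on `Γ` converge strongly to the resolvent
of the closure of `Γ`, provided the range condition holds. -/
theorem exists_limit_resolvent [CompleteSpace B] {L R : ℕ → B →L[𝕜] B} {h : ℕ → ℝ} {M ω r : ℝ}
    (hh : ∀ n, 0 < h n) (hω : 0 ≤ ω) (hr : ω < r)
    (hL : ∀ n k, ‖L n ^ k‖ ≤ M * (1 + ω * h n) ^ k) (Γ : Submodule 𝕜 (B × B))
    (hΓ : ∀ x y, (x, y) ∈ Γ → Tendsto (fun n => diffQuot (L n) (h n) x) atTop (𝓝 y))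
    (hrange : Dense {z : B | ∃ x y, (x, y) ∈ Γ ∧ z = (r : 𝕜) • x - y})
    (hR : ∀ n, IsResolventAt (diffQuot (L n) (h n)) (R n) r) :
    ∃ J : B →L[𝕜] B, (∀ z, Tendsto (fun n => R n z) atTop (𝓝 (J z))) ∧
      (∀ x y, (x, y) ∈ Γ.topologicalClosure → J ((r : 𝕜) • x - y) = x) ∧
      (∀ z, (J z, (r : 𝕜) • J z - z) ∈ Γ.topologicalClosure) ∧
      ∀ k, ‖J ^ k‖ ≤ M * ((r - ω)⁻¹) ^ k := by
  have hpow : ∀ n k, ‖R n ^ k‖ ≤ M * ((r - ω)⁻¹) ^ k := fun n k =>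
    norm_resolvent_pow_le (hh n) hω hr (hL n) (hR n) k
  have hR1 : ∀ n, ‖R n‖ ≤ M * (r - ω)⁻¹ := fun n => by simpa using hpow n 1
  have hcore : ∀ x y, (x, y) ∈ Γ → Tendsto (fun n => R n ((r : 𝕜) • x - y)) atTop (𝓝 x) := by
    intro x y hxy
    have h1 : Tendsto (fun n => R n (diffQuot (L n) (h n) x - y)) atTop (𝓝 0) := by
      refine squeeze_zero_norm (fun n => (R n).le_of_opNorm_le (hR1 n) _) ?_
      have := (tendsto_iff_norm_sub_tendsto_zero.1 (hΓ x y hxy)).const_mul (M * (r - ω)⁻¹)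
      simpa using this
    have h2 := h1.add_const x
    rw [zero_add] at h2
    refine h2.congr fun n => ?_
    nth_rewrite 2 [← (hR n).left_inv x]
    rw [← map_add]
    congr 1
    abel
  obtain ⟨J, hJ⟩ := exists_strong_limit hR1 hrange (by
    rintro _ ⟨x, y, hxy, rfl⟩
    exact (hcore x y hxy).cauchySeq)
  have hJcore : ∀ x y, (x, y) ∈ Γ → J ((r : 𝕜) • x - y) = x := fun x y hxy =>
    tendsto_nhds_unique (hJ _) (hcore x y hxy)
  refine ⟨J, hJ, fun x y hxy => ?_, fun z => ?_, fun k => ?_⟩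
  · have hcl : IsClosed {p : B × B | J ((r : 𝕜) • p.1 - p.2) = p.1} :=
      isClosed_eq (by fun_prop) (by fun_prop)
    have hsub : (Γ : Set (B × B)) ⊆ {p : B × B | J ((r : 𝕜) • p.1 - p.2) = p.1} :=
      fun p hp => hJcore p.1 p.2 hp
    exact closure_minimal hsub hcl hxy
  · have hcl : IsClosed {z : B | (J z, (r : 𝕜) • J z - z) ∈ Γ.topologicalClosure} :=
      Γ.isClosed_topologicalClosure.preimage
        (by fun_prop : Continuous fun z => (J z, (r : 𝕜) • J z - z))
    refine (hcl.closure_subset_iff.2 ?_) (hrange z)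
    rintro _ ⟨x, y, hxy, rfl⟩
    rw [Set.mem_ofPred_eq, hJcore x y hxy, sub_sub_cancel]
    exact Γ.le_topologicalClosure hxy
  · exact norm_le_of_strong (fun n => hpow n k) fun z => tendsto_pow_apply_of_strong hR1 hJ k z

end Resolvents

section StepSums

open MeasureTheory in
/-- Dominated convergence for Riemann-type sums of step functions. -/
theorem tendsto_step_sum {g : ℕ → ℕ → ℝ} {h : ℕ → ℝ} {k : ℕ → ℕ} {S C : ℝ}
    (hg : ∀ n j, 0 ≤ g n j) (hh : ∀ n, 0 < h n) (hC : ∀ n j, (j : ℕ) * h n ≤ S → g n j ≤ C)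
    (hk : ∀ n, k n * h n ≤ S)
    (hlim : ∀ σ, 0 ≤ σ → Tendsto (fun n => g n ⌊σ / h n⌋₊) atTop (𝓝 0)) :
    Tendsto (fun n => h n * ∑ j ∈ Finset.range (k n), g n j) atTop (𝓝 0) := by
  set I : ℕ → ℕ → Set ℝ := fun n j => Set.Ico (j * h n) ((j + 1) * h n) with hI
  set G : ℕ → ℝ → ℝ := fun n σ =>
    ∑ j ∈ Finset.range (k n), (I n j).indicator (fun _ => g n j) σ with hG
  have hS : 0 ≤ S := (by have := hh 0; positivity : 0 ≤ k 0 * h 0).trans (hk 0)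
  have hC0 : 0 ≤ C := (hg 0 0).trans (hC 0 0 (by simpa using hS))
  have hGneg : ∀ n σ, σ < 0 → G n σ = 0 := fun n σ hσ => by
    refine Finset.sum_eq_zero fun j _ => Set.indicator_of_notMem (fun hm => ?_) _
    have : 0 ≤ (j : ℝ) * h n := by have := hh n; positivity
    linarith [hm.1]
  have hGpos : ∀ n σ, 0 ≤ σ →
      G n σ = if ⌊σ / h n⌋₊ ∈ Finset.range (k n) then g n ⌊σ / h n⌋₊ else 0 := fun n σ hσ => by
    rw [← Finset.sum_ite_eq]
    refine Finset.sum_congr rfl fun j _ => ?_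
    have : σ ∈ I n j ↔ ⌊σ / h n⌋₊ = j := by
      rw [Nat.floor_eq_iff (div_nonneg hσ (hh n).le), le_div_iff₀ (hh n), div_lt_iff₀ (hh n)]
      rfl
    by_cases hj : ⌊σ / h n⌋₊ = j
    · rw [Set.indicator_of_mem (this.2 hj), if_pos hj]
    · rw [Set.indicator_of_notMem (fun h => hj (this.1 h)), if_neg hj]
  have hint : ∀ n, ∫ σ, G n σ = h n * ∑ j ∈ Finset.range (k n), g n j := fun n => by
    rw [integral_finsetSum, Finset.mul_sum]
    · refine Finset.sum_congr rfl fun j _ => ?_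
      rw [integral_indicator_const _ measurableSet_Ico]
      simp only [Measure.real, Real.volume_Ico, smul_eq_mul]
      rw [ENNReal.toReal_ofReal (by nlinarith [hh n])]
      ring
    · intro j _
      exact (integrable_indicator_iff measurableSet_Ico).2 (integrableOn_const (by simp))
  have hmeas : ∀ n, AEStronglyMeasurable (G n) volume := fun n => by
    refine (Finset.measurable_fun_sum _ fun j _ => ?_).aestronglyMeasurable
    exact measurable_const.indicator measurableSet_Ico
  have key := tendsto_integral_of_dominated_convergence (μ := volume) (F := G) (f := fun _ => 0)
    ((Set.Icc 0 S).indicator fun _ => C) hmeas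
    ((integrable_indicator_iff measurableSet_Icc).2 (integrableOn_const (by simp)))
    (fun n => Eventually.of_forall fun σ => by
      rcases lt_or_ge σ 0 with hσ | hσ
      · rw [hGneg n σ hσ, norm_zero]
        exact Set.indicator_nonneg (fun _ _ => hC0) _
      · rw [hGpos n σ hσ]
        split_ifs with hm
        · have hj : ((⌊σ / h n⌋₊ : ℝ) + 1) * h n ≤ S := by
            refine le_trans ?_ (hk n)
            have : (⌊σ / h n⌋₊ : ℝ) + 1 ≤ k n := by exact_mod_cast Finset.mem_range.1 hm
            exact mul_le_mul_of_nonneg_right this (hh n).le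
          have hσS : σ < (⌊σ / h n⌋₊ + 1) * h n := by
            rw [← div_lt_iff₀ (hh n)]; exact Nat.lt_floor_add_one _
          rw [Set.indicator_of_mem (Set.mem_Icc.2 ⟨hσ, by linarith⟩), Real.norm_eq_abs, abs_of_nonneg (hg _ _)]
          exact hC n _ (by nlinarith [hh n])
        · rw [norm_zero]
          exact Set.indicator_nonneg (fun _ _ => hC0) _)
    (Eventually.of_forall fun σ => by
      rcases lt_or_ge σ 0 with hσ | hσ
      · simp only [hGneg _ σ hσ]; exact tendsto_const_nhds
      · refine squeeze_zero (fun n => ?_) (fun n => ?_) (hlim σ hσ)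
        · rw [hGpos n σ hσ]; split_ifs
          exacts [hg _ _, le_rfl]
        · rw [hGpos n σ hσ]; split_ifs
          exacts [le_rfl, hg _ _])
  simpa only [hint, integral_zero] using key

end StepSums

section RangeDensity

variable {𝕜 B : Type*} [RCLike 𝕜] [NormedAddCommGroup B] [NormedSpace 𝕜 B]

theorem Submodule.dense_of_forall_dual {S : Submodule 𝕜 B}
    (h : ∀ χ : StrongDual 𝕜 B, (∀ x ∈ S, χ x = 0) → χ = 0) : Dense (S : Set B) := by
  intro x
  by_contra hx
  have hcl : IsClosed (S.topologicalClosure : Set B) := S.isClosed_topologicalClosure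
  have hx' : x ∉ S.topologicalClosure := hx
  have hne : S.topologicalClosure.mkQL x ≠ 0 := fun h0 =>
    hx' ((Submodule.Quotient.mk_eq_zero _).1 h0)
  have := S.topologicalClosure.isClosed_topologicalClosure
  obtain ⟨f, hf⟩ := SeparatingDual.exists_ne_zero (R := 𝕜) hne
  have h0 := h (f.comp S.topologicalClosure.mkQL) fun y hy => by
    have : S.topologicalClosure.mkQL y = 0 :=
      (Submodule.Quotient.mk_eq_zero _).2 (S.le_topologicalClosure hy)
    rw [ContinuousLinearMap.comp_apply, this, map_zero]
  exact hf (congrArg (fun φ : StrongDual 𝕜 B => φ x) h0)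

/-- The range `(r - Γ)`, as a submodule. -/
noncomputable def graphRange (Γ : Submodule 𝕜 (B × B)) (r : ℝ) : Submodule 𝕜 B :=
  Γ.map ((r : 𝕜) • LinearMap.fst 𝕜 B B - LinearMap.snd 𝕜 B B)

theorem coe_graphRange (Γ : Submodule 𝕜 (B × B)) (r : ℝ) :
    (graphRange Γ r : Set B) = {z : B | ∃ x y, (x, y) ∈ Γ ∧ z = (r : 𝕜) • x - y} := by
  ext z
  simp only [graphRange, SetLike.mem_coe, Submodule.mem_map, Prod.exists, Set.mem_ofPred_eq]
  refine exists_congr fun x => exists_congr fun y => and_congr_right fun _ => ?_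
  exact eq_comm

theorem dense_graphRange (Γ : Submodule 𝕜 (B × B)) (r : ℝ)
    (h : ∀ χ : StrongDual 𝕜 B, (∀ x y, (x, y) ∈ Γ → χ y = (r : 𝕜) * χ x) → χ = 0) :
    Dense {z : B | ∃ x y, (x, y) ∈ Γ ∧ z = (r : 𝕜) • x - y} := by
  rw [← coe_graphRange]
  refine Submodule.dense_of_forall_dual fun χ hχ => h χ fun x y hxy => ?_
  have := hχ ((r : 𝕜) • x - y) (by
    rw [← SetLike.mem_coe, coe_graphRange]; exact ⟨x, y, hxy, rfl⟩)
  rw [map_sub, map_smul, smul_eq_mul, sub_eq_zero] at this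
  exact this.symm

theorem dual_tendsto_zero_of_dense {w : ℕ → B} {K : ℝ} (hw : ∀ n, ‖w n‖ ≤ K)
    {Φ : Set (StrongDual 𝕜 B)} (hΦ : Dense Φ)
    (h : ∀ φ ∈ Φ, Tendsto (fun n => φ (w n)) atTop (𝓝 0)) (χ : StrongDual 𝕜 B) :
    Tendsto (fun n => χ (w n)) atTop (𝓝 0) :=
  tendsto_zero_of_dense (Q := fun n => NormedSpace.inclusionInDoubleDual 𝕜 B (w n)) (K := K)
    (fun n => (NormedSpace.double_dual_bound 𝕜 B (w n)).trans (hw n)) hΦ h χ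

theorem diffQuot_pow_apply (L : B →L[𝕜] B) (h : ℝ) (j : ℕ) (f : B) :
    diffQuot L h ((L ^ j) f) = (L ^ j) (diffQuot L h f) := by
  have : L ((L ^ j) f) = (L ^ j) (L f) := by
    rw [← mul_apply_eq_comp, ← mul_apply_eq_comp, (Commute.refl L).pow_right j]
  rw [diffQuot_apply, diffQuot_apply, map_smul, map_sub, this]

theorem norm_pow_le_exp {L : B →L[𝕜] B} {h M ω S : ℝ} (hω : 0 ≤ ω) (hh : 0 < h) (hM : 0 ≤ M)
    (hL : ∀ k, ‖L ^ k‖ ≤ M * (1 + ω * h) ^ k) {j : ℕ} (hj : j * h ≤ S) :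
    ‖L ^ j‖ ≤ M * Real.exp (ω * S) := by
  refine (hL j).trans ?_
  gcongr
  calc (1 + ω * h) ^ j ≤ Real.exp (ω * h) ^ j := by
        gcongr; rw [add_comm]; exact Real.add_one_le_exp _
    _ = Real.exp (ω * (j * h)) := by rw [← Real.exp_nat_mul]; ring_nf
    _ ≤ _ := by gcongr

theorem norm_dual_le_sum {L : B →L[𝕜] B} {h r : ℝ} (hh : 0 < h) (hr : 0 < r)
    (χ : StrongDual 𝕜 B) (f : B) (k : ℕ) :
    ‖χ f‖ ≤ ((1 + r * h)⁻¹) ^ k * ‖χ ((L ^ k) f)‖ + h * ∑ j ∈ Finset.range k,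
      ‖χ (diffQuot L h ((L ^ j) f)) - (r : 𝕜) * χ ((L ^ j) f)‖ := by
  have hpos : 0 < 1 + r * h := by positivity
  induction k with
  | zero => simp
  | succ k ih =>
    refine ih.trans ?_
    rw [Finset.sum_range_succ, mul_add]
    set e := χ (diffQuot L h ((L ^ k) f)) - (r : 𝕜) * χ ((L ^ k) f) with he
    have h𝕜 : (h : 𝕜) ≠ 0 := by exact_mod_cast hh.ne'
    have e1 : ((1 + r * h : ℝ) : 𝕜) * χ ((L ^ k) f) = χ ((L ^ (k + 1)) f) - h * e := by
      rw [he, diffQuot_apply, pow_succ', mul_apply_eq_comp, map_smul, map_sub, smul_eq_mul]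
      push_cast
      field_simp
      ring
    have e2 : (1 + r * h) * ‖χ ((L ^ k) f)‖ ≤ ‖χ ((L ^ (k + 1)) f)‖ + h * ‖e‖ := by
      have := congrArg norm e1
      rw [norm_mul, RCLike.norm_ofReal, abs_of_pos hpos] at this
      rw [this]
      refine (norm_sub_le _ _).trans (le_of_eq ?_)
      rw [norm_mul, RCLike.norm_ofReal, abs_of_pos hh]
    have e3 : ‖χ ((L ^ k) f)‖ ≤ (1 + r * h)⁻¹ * (‖χ ((L ^ (k + 1)) f)‖ + h * ‖e‖) := by
      rw [inv_mul_eq_div, le_div_iff₀ hpos, mul_comm]; exact e2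
    have e4 : ((1 + r * h)⁻¹) ^ (k + 1) ≤ 1 :=
      pow_le_one₀ (by positivity) (inv_le_one_of_one_le₀ (by nlinarith))
    have e5 : ((1 + r * h)⁻¹) ^ k * ‖χ ((L ^ k) f)‖ ≤
        ((1 + r * h)⁻¹) ^ (k + 1) * ‖χ ((L ^ (k + 1)) f)‖ + h * ‖e‖ := by
      calc _ ≤ ((1 + r * h)⁻¹) ^ k * ((1 + r * h)⁻¹ * (‖χ ((L ^ (k + 1)) f)‖ + h * ‖e‖)) := by
            gcongr
        _ = ((1 + r * h)⁻¹) ^ (k + 1) * ‖χ ((L ^ (k + 1)) f)‖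
            + ((1 + r * h)⁻¹) ^ (k + 1) * (h * ‖e‖) := by ring
        _ ≤ _ := by
            exact add_le_add le_rfl (mul_le_of_le_one_left (by positivity) e4)
    linarith

/-- The range condition: weak convergence of the adjoint difference quotients together with an
approximation of the iterates by elements on which the limit operator stays bounded. -/
theorem dense_range_of_bounded_approx {L : ℕ → B →L[𝕜] B} {h : ℕ → ℝ} {M ω r : ℝ}
    (hh : ∀ n, 0 < h n) (hh0 : Tendsto h atTop (𝓝 0)) (hω : 0 ≤ ω) (hr : ω < r)
    (hL : ∀ n k, ‖L n ^ k‖ ≤ M * (1 + ω * h n) ^ k) (Γ : Submodule 𝕜 (B × B))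
    (hΓ : ∀ x y, (x, y) ∈ Γ → Tendsto (fun n => diffQuot (L n) (h n) x) atTop (𝓝 y))
    {Φ : Set (StrongDual 𝕜 B)} (hΦ : Dense Φ)
    (hadj : ∀ φ ∈ Φ, ∃ ψ : StrongDual 𝕜 B, (∀ x y, (x, y) ∈ Γ → φ y = ψ x) ∧
      Tendsto (fun n => φ.comp (diffQuot (L n) (h n))) atTop (𝓝 ψ))
    {A : Set B} (hA : Dense A) (hAΓ : ∀ f ∈ A, ∃ y, (f, y) ∈ Γ)
    (happ : ∀ f ∈ A, ∀ σ : ℝ, 0 ≤ σ → ∃ u v : ℕ → B, (∀ n, (u n, v n) ∈ Γ) ∧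
      (∃ K, ∀ n, ‖v n‖ ≤ K) ∧
      Tendsto (fun n => (L n ^ ⌊σ / h n⌋₊) f - u n) atTop (𝓝 0)) :
    Dense {z : B | ∃ x y, (x, y) ∈ Γ ∧ z = (r : 𝕜) • x - y} := by
  have hM : 0 ≤ M := by have := (norm_nonneg _).trans (hL 0 0); simpa using this
  refine dense_graphRange Γ r fun χ hχ => ?_
  suffices hf : ∀ f ∈ A, χ f = 0 by
    ext x
    exact isClosed_property hA.denseRange_val (isClosed_eq χ.continuous continuous_const)
      (fun f : A => hf f f.2) x
  intro f hfA
  obtain ⟨y, hfy⟩ := hAΓ f hfA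
  obtain ⟨K₀, hK₀⟩ : ∃ K₀, ∀ n, ‖diffQuot (L n) (h n) f‖ ≤ K₀ := by
    obtain ⟨K, hK⟩ := (Metric.isBounded_range_of_tendsto _ (hΓ f y hfy)).exists_norm_le
    exact ⟨K, fun n => hK _ ⟨n, rfl⟩⟩
  have hpow : ∀ S n (j : ℕ), j * h n ≤ S → ‖L n ^ j‖ ≤ M * Real.exp (ω * S) := fun S n j hj =>
    norm_pow_le_exp hω (hh n) hM (hL n) hj
  have hfloor : ∀ σ n, 0 ≤ σ → ⌊σ / h n⌋₊ * h n ≤ σ := fun σ n hσ => by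
    rw [← le_div_iff₀ (hh n)]; exact Nat.floor_le (div_nonneg hσ (hh n).le)
  set E : ℕ → ℕ → ℝ := fun n j =>
    ‖χ (diffQuot (L n) (h n) ((L n ^ j) f)) - (r : 𝕜) * χ ((L n ^ j) f)‖ with hE
  have hEbound : ∀ S n (j : ℕ), j * h n ≤ S →
      E n j ≤ ‖χ‖ * (M * Real.exp (ω * S) * K₀) + r * (‖χ‖ * (M * Real.exp (ω * S) * ‖f‖)) := by
    intro S n j hj
    have hr0 : 0 ≤ r := hω.trans hr.le
    refine (norm_sub_le _ _).trans (add_le_add ?_ ?_)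
    · rw [diffQuot_pow_apply]
      refine χ.le_opNorm_of_le (((L n ^ j).le_of_opNorm_le (hpow S n j hj) _).trans ?_)
      gcongr; exact hK₀ n
    · rw [norm_mul, RCLike.norm_ofReal, abs_of_nonneg hr0]
      gcongr
      exact χ.le_opNorm_of_le ((L n ^ j).le_of_opNorm_le (hpow S n j hj) _)
  have hElim : ∀ σ, 0 ≤ σ → Tendsto (fun n => E n ⌊σ / h n⌋₊) atTop (𝓝 0) := by
    intro σ hσ
    obtain ⟨u, v, huv, ⟨K, hK⟩, hu⟩ := happ f hfA σ hσ
    set p : ℕ → B := fun n => (L n ^ ⌊σ / h n⌋₊) f with hp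
    have hpb : ∀ n, ‖p n‖ ≤ M * Real.exp (ω * σ) * ‖f‖ := fun n =>
      (L n ^ _).le_of_opNorm_le (hpow σ n _ (hfloor σ n hσ)) _
    have hzb : ∀ n, ‖diffQuot (L n) (h n) (p n) - v n‖ ≤ M * Real.exp (ω * σ) * K₀ + K := by
      intro n
      refine (norm_sub_le _ _).trans (add_le_add ?_ (hK n))
      rw [hp, diffQuot_pow_apply]
      refine ((L n ^ _).le_of_opNorm_le (hpow σ n _ (hfloor σ n hσ)) _).trans ?_
      gcongr; exact hK₀ n
    have hweak := dual_tendsto_zero_of_dense hzb hΦ (fun φ hφ => by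
      obtain ⟨ψ, hψ, hlim⟩ := hadj φ hφ
      have h1 : Tendsto (fun n => (φ.comp (diffQuot (L n) (h n)) - ψ) (p n)) atTop (𝓝 0) := by
        refine squeeze_zero_norm
          (fun n => ContinuousLinearMap.le_opNorm_of_le _ (hpb n)) ?_
        have := (tendsto_iff_norm_sub_tendsto_zero.1 hlim).mul_const (M * Real.exp (ω * σ) * ‖f‖)
        simpa using this
      have h2 : Tendsto (fun n => ψ (p n - u n)) atTop (𝓝 0) := by
        have := (ψ.continuous.tendsto 0).comp hu
        rwa [map_zero] at this
      have h3 := h1.add h2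
      rw [add_zero] at h3
      refine h3.congr fun n => ?_
      rw [map_sub, map_sub, hψ _ _ (huv n)]
      simp) χ
    have h2 : Tendsto (fun n => (r : 𝕜) * χ (p n - u n)) atTop (𝓝 0) := by
      have := ((χ.continuous.tendsto 0).comp hu).const_mul (r : 𝕜)
      rwa [map_zero, mul_zero] at this
    have h3 := (hweak.sub h2).norm
    rw [sub_zero, norm_zero] at h3
    refine h3.congr fun n => ?_
    rw [hE, map_sub, map_sub, hχ _ _ (huv n)]
    congr 1
    ring
  have hbound : ∀ S, 0 ≤ S → ‖χ f‖ ≤ Real.exp (-(r - ω) * S) * (‖χ‖ * (M * ‖f‖)) := by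
    intro S hS
    have hsum := tendsto_step_sum (g := E) (k := fun n => ⌊S / h n⌋₊) (fun n j => norm_nonneg _) hh
      (hEbound S) (fun n => hfloor S n hS) hElim
    have hkh : Tendsto (fun n => ⌊S / h n⌋₊ * h n) atTop (𝓝 S) := by
      have h1 : Tendsto (fun n => S - h n) atTop (𝓝 S) := by simpa using hh0.const_sub S
      refine tendsto_of_tendsto_of_tendsto_of_le_of_le h1 tendsto_const_nhds (fun n => ?_)
        (fun n => hfloor S n hS)
      have := (div_lt_iff₀ (hh n)).1 (Nat.lt_floor_add_one (S / h n))
      change S - h n ≤ ⌊S / h n⌋₊ * h n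
      linarith
    have hexp : Tendsto (fun n => Real.exp (-(r - ω) * (⌊S / h n⌋₊ * h n) / (1 + r * h n)))
        atTop (𝓝 (Real.exp (-(r - ω) * S))) := by
      refine (Real.continuous_exp.tendsto _).comp ?_
      have := (hkh.const_mul (-(r - ω))).div ((hh0.const_mul r).const_add 1) (by simp)
      rw [mul_zero, add_zero, div_one] at this
      exact this
    have hlim := (hexp.mul_const (‖χ‖ * (M * ‖f‖))).add hsum
    rw [add_zero] at hlim
    refine ge_of_tendsto' hlim fun n => ?_
    refine (norm_dual_le_sum (L := L n) (hh n) (hω.trans_lt hr) χ f ⌊S / h n⌋₊).trans ?_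
    refine add_le_add ?_ le_rfl
    have hr0 : 0 < r := hω.trans_lt hr
    have hpos : 0 < 1 + r * h n := by have := hh n; positivity
    have h1 : ‖χ ((L n ^ ⌊S / h n⌋₊) f)‖ ≤ (1 + ω * h n) ^ ⌊S / h n⌋₊ * (‖χ‖ * (M * ‖f‖)) := by
      refine (χ.le_opNorm_of_le ((L n ^ _).le_of_opNorm_le (hL n _) f)).trans (le_of_eq ?_)
      ring
    have h2 : ((1 + r * h n)⁻¹) ^ ⌊S / h n⌋₊ * (1 + ω * h n) ^ ⌊S / h n⌋₊ ≤
        Real.exp (-(r - ω) * (⌊S / h n⌋₊ * h n) / (1 + r * h n)) := by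
      rw [← mul_pow]
      have e : (1 + r * h n)⁻¹ * (1 + ω * h n) ≤ Real.exp (-(r - ω) * h n / (1 + r * h n)) := by
        refine le_trans (le_of_eq ?_) (Real.add_one_le_exp _)
        field_simp
        ring
      refine (pow_le_pow_left₀ (by have := hh n; positivity) e _).trans (le_of_eq ?_)
      rw [← Real.exp_nat_mul]
      congr 1
      ring
    calc _ ≤ ((1 + r * h n)⁻¹) ^ ⌊S / h n⌋₊ *
          ((1 + ω * h n) ^ ⌊S / h n⌋₊ * (‖χ‖ * (M * ‖f‖))) := by gcongr
      _ = ((1 + r * h n)⁻¹) ^ ⌊S / h n⌋₊ * (1 + ω * h n) ^ ⌊S / h n⌋₊ * (‖χ‖ * (M * ‖f‖)) := by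
          ring
      _ ≤ _ := by gcongr
  have hlim : Tendsto (fun S : ℝ => Real.exp (-(r - ω) * S) * (‖χ‖ * (M * ‖f‖))) atTop (𝓝 0) := by
    have : Tendsto (fun S : ℝ => -(r - ω) * S) atTop atBot :=
      tendsto_id.const_mul_atTop_of_neg (by linarith)
    simpa using (Real.tendsto_exp_atBot.comp this).mul_const (‖χ‖ * (M * ‖f‖))
  have : ‖χ f‖ ≤ 0 := ge_of_tendsto hlim (by
    filter_upwards [eventually_ge_atTop 0] with S hS using hbound S hS)
  exact norm_le_zero_iff.1 this

end RangeDensity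

section Chernoff

variable {𝕜 B : Type*} [RCLike 𝕜] [NormedAddCommGroup B] [NormedSpace 𝕜 B]

theorem IsResolventAt.commute_diffQuot {L R : B →L[𝕜] B} {h r : ℝ} (hh : h ≠ 0)
    (hR : IsResolventAt (diffQuot L h) R r) : Commute R L := by
  have h𝕜 : (h : 𝕜) ≠ 0 := by exact_mod_cast hh
  have hA : Commute R (diffQuot L h) := by
    ext x
    have h1 := hR.left_inv x
    have h2 := hR.right_inv x
    rw [map_sub, map_smul] at h1
    rw [mul_apply_eq_comp, mul_apply_eq_comp]
    exact sub_right_injective (h1.trans h2.symm)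
  have hLA : L = (h : 𝕜) • diffQuot L h + 1 := by
    rw [diffQuot, smul_smul, mul_inv_cancel₀ h𝕜, one_smul, sub_add_cancel]
  rw [hLA]
  exact (hA.smul_right (h : 𝕜)).add_right (Commute.one_right R)

theorem pow_sub_pow_eq_sum (L U : B →L[𝕜] B) (k : ℕ) :
    L ^ k - U ^ k = ∑ j ∈ Finset.range k, L ^ (k - 1 - j) * ((L - U) * U ^ j) := by
  induction k with
  | zero => simp
  | succ k ih =>
    rw [Finset.sum_range_succ]
    have e : ∑ j ∈ Finset.range k, L ^ (k + 1 - 1 - j) * ((L - U) * U ^ j)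
        = L * ∑ j ∈ Finset.range k, L ^ (k - 1 - j) * ((L - U) * U ^ j) := by
      rw [Finset.mul_sum]
      refine Finset.sum_congr rfl fun j hj => ?_
      have := Finset.mem_range.1 hj
      rw [show k + 1 - 1 - j = (k - 1 - j) + 1 by omega, pow_succ', mul_assoc]
    rw [e, ← ih]
    simp only [add_tsub_cancel_right, tsub_self, pow_zero, one_mul]
    rw [mul_sub, sub_mul, pow_succ', pow_succ']
    abel

theorem IsC0Semigroup.pow_eq {T : ℝ≥0 → B →L[𝕜] B} (hT : IsC0Semigroup T) (τ : ℝ≥0) (j : ℕ) :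
    T τ ^ j = T (j * τ) := by
  induction j with
  | zero => simp [hT.map_zero]
  | succ j ih => rw [pow_succ, ih, ← hT.map_add]; congr 1; push_cast; ring

/-- **Chernoff's product formula** when the limit semigroup is known to exist. -/
theorem IsC0Generator.tendsto_pow_apply [CompleteSpace B] {G : B →ₗ.[𝕜] B} {T : ℝ≥0 → B →L[𝕜] B}
    (hG : IsC0Generator G T) (hd : Dense (G.domain : Set B))
    {L R : ℕ → B →L[𝕜] B} {J : B →L[𝕜] B} {h : ℕ → ℝ} {M ω r : ℝ}
    (hh : ∀ n, 0 < h n) (hh0 : Tendsto h atTop (𝓝 0)) (hω : 0 ≤ ω) (hr : ω < r)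
    (hL : ∀ n k, ‖L n ^ k‖ ≤ M * (1 + ω * h n) ^ k)
    (hR : ∀ n, IsResolventAt (diffQuot (L n) (h n)) (R n) r)
    (hJ : ∀ z, Tendsto (fun n => R n z) atTop (𝓝 (J z)))
    (hJG : ∀ x y, (x, y) ∈ G.graph → J ((r : 𝕜) • x - y) = x)
    (hGJ : ∀ z, (J z, (r : 𝕜) • J z - z) ∈ G.graph)
    {k : ℕ → ℕ} {s : ℝ≥0} (hk : Tendsto (fun n => k n * h n) atTop (𝓝 (s : ℝ))) (f : B) :
    Tendsto (fun n => (L n ^ k n) f) atTop (𝓝 (T s f)) := by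
  have hM : 0 ≤ M := by have := (norm_nonneg _).trans (hL 0 0); simpa using this
  have hR1 : ∀ n, ‖R n‖ ≤ M * (r - ω)⁻¹ := fun n => by
    simpa using norm_resolvent_pow_le (hh n) hω hr (hL n) (hR n) 1
  obtain ⟨S, hS⟩ : ∃ S, ∀ n, k n * h n ≤ S := by
    obtain ⟨S, hS⟩ := (Metric.isBounded_range_of_tendsto _ hk).exists_norm_le
    exact ⟨S, fun n => (Real.le_norm_self _).trans (hS _ ⟨n, rfl⟩)⟩
  have hpow : ∀ n (j : ℕ), j * h n ≤ S → ‖L n ^ j‖ ≤ M * Real.exp (ω * S) := fun n j hj =>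
    norm_pow_le_exp hω (hh n) hM (hL n) hj
  obtain ⟨KT, hKT, hTb⟩ := hG.1.exists_norm_le S.toNNReal
  set τ : ℕ → ℝ≥0 := fun n => ⟨h n, (hh n).le⟩ with hτ
  have hτh : ∀ n, (τ n : ℝ) = h n := fun n => rfl
  have hτ0 : Tendsto τ atTop (𝓝[>] 0) := by
    refine tendsto_nhdsWithin_iff.2 ⟨?_, Eventually.of_forall fun n => hh n⟩
    rw [← NNReal.tendsto_coe]; exact hh0
  have hTτ : ∀ n (j : ℕ), j * h n ≤ S → ‖T (j * τ n)‖ ≤ KT := fun n j hj => by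
    refine hTb _ ?_
    rw [← NNReal.coe_le_coe]
    exact hj.trans (Real.le_coe_toNNReal S)
  have hcomm : ∀ σ z, T σ (J z) = J (T σ z) := fun σ z => by
    have := hJG _ _ (hG.map_mem_graph (hGJ z) σ)
    rw [← this]
    congr 1
    rw [map_sub, map_smul]
    abel
  set Q : ℕ → B →L[𝕜] B := fun n =>
    R n * (diffQuot (L n) (h n) - diffQuot (T (τ n)) (h n)) * J with hQ
  have hQ0 : ∀ z, Tendsto (fun n => Q n z) atTop (𝓝 ((0 : B →L[𝕜] B) z)) := by
    intro z
    have h1 : Tendsto (fun n => diffQuot (T (τ n)) (h n) (J z)) atTop (𝓝 ((r : 𝕜) • J z - z)) := by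
      refine (((hG.2 _ _).1 (hGJ z)).comp hτ0).congr fun n => ?_
      simp [diffQuot_apply, hG.1.map_zero, hτh]
    have h2 := tendsto_apply_of_strong hR1 hJ h1
    have h3 := ((hJ ((r : 𝕜) • J z)).sub_const (J z)).sub h2
    rw [map_sub, sub_sub_sub_cancel_left, sub_self] at h3
    refine h3.congr fun n => ?_
    have h4 := (hR n).left_inv (J z)
    rw [map_sub, sub_eq_iff_eq_add] at h4
    simp only [hQ, mul_apply_eq_comp, sub_apply, map_sub]
    rw [h4]
    abel
  obtain ⟨KQ, hKQ⟩ : ∃ C, ∀ n, ‖Q n‖ ≤ C := banach_steinhaus fun z => by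
    obtain ⟨C, hC⟩ := (Metric.isBounded_range_of_tendsto _ (hQ0 z)).exists_norm_le
    exact ⟨C, fun n => hC _ ⟨n, rfl⟩⟩
  have hKQ0 : 0 ≤ KQ := (norm_nonneg _).trans (hKQ 0)
  have hTlim : ∀ {j : ℕ → ℕ} {σ : ℝ≥0}, Tendsto (fun n => j n * h n) atTop (𝓝 (σ : ℝ)) → ∀ z,
      Tendsto (fun n => T (j n * τ n) z) atTop (𝓝 (T σ z)) := by
    intro j σ hj z
    refine ((hG.1.strongly_continuous z).tendsto σ).comp ?_
    rw [← NNReal.tendsto_coe]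
    exact hj
  have hsum : ∀ g, Tendsto (fun n => h n * ∑ j ∈ Finset.range (k n), ‖Q n (T (j * τ n) g)‖)
      atTop (𝓝 0) := by
    intro g
    refine tendsto_step_sum (g := fun n j => ‖Q n (T (j * τ n) g)‖) (S := S)
      (C := KQ * (KT * ‖g‖)) (fun n j => norm_nonneg _) hh (fun n j hj => ?_) hS fun σ hσ => ?_
    · exact ((Q n).le_of_opNorm_le (hKQ n) _).trans
        (mul_le_mul_of_nonneg_left ((T _).le_of_opNorm_le (hTτ n j hj) g) hKQ0)
    · have hfl : Tendsto (fun n => (⌊σ / h n⌋₊ : ℝ) * h n) atTop (𝓝 ((⟨σ, hσ⟩ : ℝ≥0) : ℝ)) := by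
        have h1 : Tendsto (fun n => σ - h n) atTop (𝓝 σ) := by simpa using hh0.const_sub σ
        refine tendsto_of_tendsto_of_tendsto_of_le_of_le h1 tendsto_const_nhds (fun n => ?_)
          (fun n => ?_)
        · have := (div_lt_iff₀ (hh n)).1 (Nat.lt_floor_add_one (σ / h n))
          change σ - h n ≤ ⌊σ / h n⌋₊ * h n
          linarith
        · change ⌊σ / h n⌋₊ * h n ≤ σ
          rw [← le_div_iff₀ (hh n)]; exact Nat.floor_le (div_nonneg hσ (hh n).le)
      simpa using (tendsto_apply_of_strong hKQ hQ0 (hTlim hfl g)).norm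
  have hRcomm : ∀ n j x, R n ((L n ^ j) x) = (L n ^ j) (R n x) := fun n j x =>
    congrArg (fun A : B →L[𝕜] B => A x) (((hR n).commute_diffQuot (hh n).ne').pow_right j).eq
  have htel : ∀ g, Tendsto (fun n => R n ((L n ^ k n) (J g) - T (k n * τ n) (J g))) atTop (𝓝 0) := by
    intro g
    refine squeeze_zero_norm (fun n => ?_)
      (by simpa using (hsum g).const_mul (M * Real.exp (ω * S)))
    have h𝕜 : (h n : 𝕜) ≠ 0 := by exact_mod_cast (hh n).ne'
    have e1 : R n ((L n ^ k n) (J g) - T (k n * τ n) (J g)) = ∑ j ∈ Finset.range (k n),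
        (L n ^ (k n - 1 - j)) ((h n : 𝕜) • Q n (T (j * τ n) g)) := by
      rw [← hG.1.pow_eq, ← sub_apply, pow_sub_pow_eq_sum, sum_apply, map_sum]
      refine Finset.sum_congr rfl fun j _ => ?_
      rw [mul_apply_eq_comp, hRcomm, mul_apply_eq_comp, hG.1.pow_eq, hcomm]
      congr 1
      simp only [hQ, mul_apply_eq_comp, sub_apply, diffQuot_apply]
      rw [← smul_sub, sub_sub_sub_cancel_right, map_smul, smul_smul, mul_inv_cancel₀ h𝕜, one_smul]
    rw [e1, Finset.mul_sum, Finset.mul_sum]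
    refine (norm_sum_le _ _).trans (Finset.sum_le_sum fun j hj => ?_)
    have hj' : ((k n - 1 - j : ℕ) : ℝ) * h n ≤ S := by
      refine le_trans ?_ (hS n)
      have : ((k n - 1 - j : ℕ) : ℝ) ≤ k n := by exact_mod_cast (by omega)
      exact mul_le_mul_of_nonneg_right this (hh n).le
    refine ((L n ^ _).le_of_opNorm_le (hpow n _ hj') _).trans (le_of_eq ?_)
    rw [norm_smul, RCLike.norm_ofReal, abs_of_pos (hh n)]
  have hcore : ∀ g, Tendsto (fun n => (L n ^ k n - T (k n * τ n)) (J (J g))) atTop (𝓝 0) := by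
    intro g
    have h1 : Tendsto (fun n => (L n ^ k n) (J (J g) - R n (J g))) atTop (𝓝 0) := by
      refine squeeze_zero_norm (fun n => (L n ^ _).le_of_opNorm_le (hpow n _ (hS n)) _) ?_
      have := ((hJ (J g)).const_sub (J (J g))).norm.const_mul (M * Real.exp (ω * S))
      simpa using this
    have h2 := tendsto_apply_of_strong hR1 hJ (hTlim hk (J g))
    have h3 := (J.continuous.tendsto _).comp (hTlim hk (J g))
    have h4 := (h1.add (htel g)).add (h2.sub h3)
    rw [sub_self, add_zero, add_zero] at h4
    refine h4.congr fun n => ?_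
    simp only [sub_apply, map_sub, Function.comp_apply, hRcomm, hcomm]
    abel
  have hJd : DenseRange J := by
    refine hd.mono fun x hx => ?_
    obtain ⟨y, hxy⟩ := LinearPMap.mem_domain_iff.1 hx
    exact ⟨_, hJG x y hxy⟩
  have hJJ : DenseRange fun g => J (J g) := hJd.comp hJd J.continuous
  have := tendsto_zero_of_dense (Q := fun n => L n ^ k n - T (k n * τ n))
    (K := M * Real.exp (ω * S) + KT)
    (fun n => (norm_sub_le _ _).trans (add_le_add (hpow n _ (hS n)) (hTτ n _ (hS n)))) hJJ
    (by rintro _ ⟨g, rfl⟩; exact hcore g) f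
  simpa using this.add (hTlim hk f)

end Chernoff

section HilleYosida

variable {𝕜 B : Type*} [RCLike 𝕜] [NormedAddCommGroup B] [NormedSpace 𝕜 B]

/-- Mean value inequality for a function of a scalar variable, along the nonnegative reals. -/
theorem norm_sub_sub_smul_le_of_hasDerivAt {F F' : 𝕜 → B} (hF : ∀ z, HasDerivAt F (F' z) z)
    {y : B} {C : ℝ} {s : ℝ} (hs : 0 ≤ s)
    (hC : ∀ σ : ℝ, 0 ≤ σ → σ ≤ s → ‖F' (σ : 𝕜) - y‖ ≤ C) :
    ‖F (s : 𝕜) - F 0 - (s : 𝕜) • y‖ ≤ C * s := by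
  have hC0 : 0 ≤ C := (norm_nonneg _).trans (hC 0 le_rfl hs)
  refine NormedSpace.norm_le_dual_bound 𝕜 _ (by positivity) fun φ => ?_
  have hd : ∀ σ : ℝ, HasDerivAt (fun σ : ℝ => φ (F (σ : 𝕜)) - (σ : 𝕜) * φ y)
      (φ (F' (σ : 𝕜)) - φ y) σ := fun σ => by
    have h0 : HasDerivAt (fun σ : ℝ => (σ : 𝕜)) 1 σ := by
      simpa using (RCLike.ofRealCLM (K := 𝕜)).hasDerivAt (x := σ)
    have h1 : HasDerivAt (fun z : 𝕜 => φ (F z)) (φ (F' (σ : 𝕜))) (σ : 𝕜) :=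
      φ.hasFDerivAt.comp_hasDerivAt _ (hF _)
    have h2 := (h1.comp σ h0).sub (h0.mul_const (φ y))
    rw [mul_one, one_mul] at h2
    exact h2
  have key := norm_image_sub_le_of_norm_deriv_le_segment' (a := 0) (b := s) (C := ‖φ‖ * C)
    (fun σ _ => (hd σ).hasDerivWithinAt)
    (fun σ hσ => by
      rw [← map_sub]
      exact φ.le_opNorm_of_le (hC σ hσ.1 hσ.2.le)) s ⟨hs, le_rfl⟩
  rw [map_sub, map_sub, map_smul, smul_eq_mul]
  simp only [RCLike.ofReal_zero, zero_mul, sub_zero] at key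
  rw [sub_right_comm]
  refine key.trans (le_of_eq (by ring))

open NormedSpace in
theorem hasDerivAt_exp_smul_apply [CompleteSpace B] (P : B →L[𝕜] B) (f : B) (z : 𝕜) :
    HasDerivAt (fun z : 𝕜 => exp (z • P) f) (exp (z • P) (P f)) z := by
  have := (hasDerivAt_exp_smul_const P z).clm_apply (hasDerivAt_const z f)
  simpa using this

open NormedSpace in
theorem norm_exp_smul_apply_sub_le [CompleteSpace B] (P : B →L[𝕜] B) (f y : B) {C s : ℝ}
    (hs : 0 ≤ s) (hC : ∀ σ : ℝ, 0 ≤ σ → σ ≤ s → ‖exp ((σ : 𝕜) • P) (P f) - y‖ ≤ C) :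
    ‖exp ((s : 𝕜) • P) f - f - (s : 𝕜) • y‖ ≤ C * s := by
  have := norm_sub_sub_smul_le_of_hasDerivAt (hasDerivAt_exp_smul_apply P f) hs hC
  simpa using this

open NormedSpace in
theorem norm_exp_smul_sub_exp_smul_le [CompleteSpace B] {P Q : B →L[𝕜] B} (hPQ : Commute P Q)
    (f : B) {K s : ℝ} (hs : 0 ≤ s)
    (hP : ∀ σ : ℝ, 0 ≤ σ → σ ≤ s → ‖exp ((σ : 𝕜) • P)‖ ≤ K)
    (hQ : ∀ σ : ℝ, 0 ≤ σ → σ ≤ s → ‖exp ((σ : 𝕜) • Q)‖ ≤ K) :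
    ‖exp ((s : 𝕜) • P) f - exp ((s : 𝕜) • Q) f‖ ≤ K * (K * ‖P f - Q f‖) * s := by
  have hK : 0 ≤ K := (norm_nonneg _).trans (hP 0 le_rfl hs)
  have hd : ∀ z : 𝕜, HasDerivAt (fun z : 𝕜 => exp (z • P) (exp (((s : 𝕜) - z) • Q) f))
      (exp (z • P) (exp (((s : 𝕜) - z) • Q) (P f - Q f))) z := fun z => by
    have h1 : HasDerivAt (fun z : 𝕜 => exp (((s : 𝕜) - z) • Q) f)
        (-(exp (((s : 𝕜) - z) • Q) (Q f))) z := by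
      have := (hasDerivAt_exp_smul_apply Q f ((s : 𝕜) - z)).scomp z
        ((hasDerivAt_id z).const_sub (s : 𝕜))
      rw [neg_one_smul] at this
      exact this
    have h2 := (hasDerivAt_exp_smul_const P z).clm_apply h1
    convert h2 using 1
    have hc : Commute P (exp (((s : 𝕜) - z) • Q)) := (hPQ.smul_right _).exp_right
    have hc' : P (exp (((s : 𝕜) - z) • Q) f) = exp (((s : 𝕜) - z) • Q) (P f) :=
      congrArg (fun A : B →L[𝕜] B => A f) hc.eq
    rw [mul_apply_eq_comp, hc', map_sub, map_sub, map_neg, sub_eq_add_neg]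
  have := norm_sub_sub_smul_le_of_hasDerivAt hd (y := 0) (C := K * (K * ‖P f - Q f‖)) hs
    (fun σ h0 h1 => by
      rw [sub_zero]
      refine (ContinuousLinearMap.le_of_opNorm_le _ (hP σ h0 h1) _).trans ?_
      gcongr
      rw [← RCLike.ofReal_sub]
      exact ContinuousLinearMap.le_of_opNorm_le _ (hQ _ (by linarith) (by linarith)) _)
  simpa using this

open NormedSpace in
/-- The exponential of a Yosida approximation. -/
theorem norm_exp_yosida_le [CompleteSpace B] {J : B →L[𝕜] B} {M ω μ : ℝ} (hω : 0 ≤ ω)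
    (hμ : 2 * ω < μ) (hJ : ∀ k, ‖J ^ k‖ ≤ M * ((μ - ω)⁻¹) ^ k) {s : ℝ} (hs : 0 ≤ s) :
    ‖exp ((s : 𝕜) • ((μ : 𝕜) • ((μ : 𝕜) • J - 1)))‖ ≤ M * Real.exp (2 * ω * s) := by
  have hM : 0 ≤ M := by have := (norm_nonneg _).trans (hJ 0); simpa using this
  have hpos : 0 < μ - ω := by linarith
  let _ : NormedAlgebra ℚ (B →L[𝕜] B) := NormedAlgebra.restrictScalars ℚ 𝕜 _
  have e1 : (s : 𝕜) • ((μ : 𝕜) • ((μ : 𝕜) • J - 1))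
      = ((s * μ ^ 2 : ℝ) : 𝕜) • J + ((-(s * μ) : ℝ) : 𝕜) • (1 : B →L[𝕜] B) := by
    push_cast; module
  have hexp1 : ‖exp (((s * μ ^ 2 : ℝ) : 𝕜) • J)‖ ≤ M * Real.exp (s * μ ^ 2 / (μ - ω)) := by
    rw [exp_eq_tsum 𝕜]
    have hs := (NormedSpace.expSeries_div_hasSum_exp (s * μ ^ 2 / (μ - ω))).mul_left M
    rw [← Real.exp_eq_exp_ℝ] at hs
    refine tsum_of_norm_bounded hs fun k => ?_
    rw [smul_pow, norm_smul, norm_smul, norm_inv, RCLike.norm_natCast, norm_pow,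
      RCLike.norm_ofReal, abs_of_nonneg (by positivity), div_pow]
    calc _ ≤ ((k.factorial : ℝ)⁻¹) * ((s * μ ^ 2) ^ k * (M * ((μ - ω)⁻¹) ^ k)) := by
          gcongr; exact hJ k
      _ = _ := by rw [inv_pow]; field_simp
  have hexp2 : exp (((-(s * μ) : ℝ) : 𝕜) • (1 : B →L[𝕜] B))
      = ((Real.exp (-(s * μ)) : ℝ) : 𝕜) • 1 := by
    rw [← Algebra.algebraMap_eq_smul_one, ← Algebra.algebraMap_eq_smul_one,
      ← algebraMap_exp_comm, Real.exp_eq_exp_ℝ]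
    congr 1
    exact (algebraMap_exp_comm (𝕂 := ℝ) (𝔸 := 𝕜) _).symm
  rw [e1, exp_add_of_commute ((Commute.one_right _).smul_right _), hexp2, mul_smul_comm, mul_one,
    norm_smul, RCLike.norm_ofReal, abs_of_pos (Real.exp_pos _)]
  calc _ ≤ Real.exp (-(s * μ)) * (M * Real.exp (s * μ ^ 2 / (μ - ω))) := by gcongr
    _ = M * Real.exp (s * (ω * μ / (μ - ω))) := by
        rw [mul_left_comm, ← Real.exp_add]
        congr 2
        field_simp
        ring
    _ ≤ M * Real.exp (2 * ω * s) := by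
        have : ω * μ / (μ - ω) ≤ 2 * ω := by
          rw [div_le_iff₀ hpos]; nlinarith
        have h2 := mul_le_mul_of_nonneg_left this hs
        rw [mul_comm s (2 * ω)] at h2
        exact mul_le_mul_of_nonneg_left (Real.exp_le_exp.2 h2) hM

theorem commute_of_resolvents {Γ : Submodule 𝕜 (B × B)} {J₁ J₂ : B →L[𝕜] B} {r₁ r₂ : ℝ}
    (h₁ : ∀ x y, (x, y) ∈ Γ → J₁ ((r₁ : 𝕜) • x - y) = x)
    (h₁' : ∀ z, (J₁ z, (r₁ : 𝕜) • J₁ z - z) ∈ Γ)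
    (h₂ : ∀ x y, (x, y) ∈ Γ → J₂ ((r₂ : 𝕜) • x - y) = x)
    (h₂' : ∀ z, (J₂ z, (r₂ : 𝕜) • J₂ z - z) ∈ Γ) (hne : r₁ ≠ r₂) : Commute J₁ J₂ := by
  ext z
  have e1 := h₁ _ _ (h₂' z)
  have e2 := h₂ _ _ (h₁' z)
  simp only [map_sub, map_smul] at e1 e2
  rw [mul_apply_eq_comp, mul_apply_eq_comp]
  have hne' : ((r₁ : 𝕜) - r₂) ≠ 0 := by
    rw [sub_ne_zero]; exact_mod_cast hne
  refine smul_right_injective B hne' ?_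
  have e3 := congrArg₂ (· + ·) e1 e2
  simp only at e3 ⊢
  rw [← sub_eq_zero] at e3 ⊢
  rw [← e3]
  module

theorem IsC0Semigroup.of_uniform_bound {T : ℝ≥0 → B →L[𝕜] B} {M a : ℝ} (h0 : T 0 = 1)
    (hadd : ∀ l m, T (l + m) = T l * T m) (hb : ∀ s : ℝ≥0, ‖T s‖ ≤ M * Real.exp (a * s))
    (hc : ∀ x, Continuous fun s => T s x) : IsC0Semigroup T :=
  ⟨h0, hadd, hc, max M 1, a, le_max_right _ _, fun s => (hb s).trans (by
    gcongr; exact le_max_left _ _)⟩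

open NormedSpace in
/-- **Hille–Yosida theorem**, in the general (Feller–Miyadera–Phillips) form. -/
theorem exists_isC0Generator [CompleteSpace B] {G : B →ₗ.[𝕜] B} (hd : Dense (G.domain : Set B))
    {M ω : ℝ} (hω : 0 ≤ ω) {J : ℝ → B →L[𝕜] B}
    (hJG : ∀ μ, ω < μ → ∀ x y, (x, y) ∈ G.graph → J μ ((μ : 𝕜) • x - y) = x)
    (hGJ : ∀ μ, ω < μ → ∀ z, (J μ z, (μ : 𝕜) • J μ z - z) ∈ G.graph)
    (hJ : ∀ μ, ω < μ → ∀ k, ‖J μ ^ k‖ ≤ M * ((μ - ω)⁻¹) ^ k) :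
    ∃ T : ℝ≥0 → B →L[𝕜] B, IsC0Generator G T := by
  have hM : 0 ≤ M := by
    have := (norm_nonneg _).trans (hJ (ω + 1) (by linarith) 0); simpa using this
  set μ : ℕ → ℝ := fun n => 2 * ω + 1 + n with hμ
  have hμ1 : ∀ n, 2 * ω + 1 ≤ μ n := fun n => by
    have : (0 : ℝ) ≤ n := n.cast_nonneg
    simp only [hμ]; linarith
  have hμω : ∀ n, ω < μ n := fun n => by have := hμ1 n; linarith
  have hμtop : Tendsto μ atTop atTop :=
    tendsto_atTop_add_const_left _ _ tendsto_natCast_atTop_atTop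
  set Y : ℕ → B →L[𝕜] B := fun n => (μ n : 𝕜) • ((μ n : 𝕜) • J (μ n) - 1) with hY
  have hYcomm : ∀ n m, Commute (Y n) (Y m) := by
    intro n m
    by_cases hnm : n = m
    · rw [hnm]
    have hne : μ n ≠ μ m := fun h => hnm (by simpa [hμ] using h)
    have := commute_of_resolvents (hJG _ (hμω n)) (hGJ _ (hμω n)) (hJG _ (hμω m))
      (hGJ _ (hμω m)) hne
    refine Commute.smul_left (Commute.smul_right ?_ _) _
    exact (((this.smul_left _).smul_right _).sub_left (Commute.one_left _)).sub_right
      (Commute.one_right _)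
  have hYexp : ∀ n (s : ℝ), 0 ≤ s → ‖exp ((s : 𝕜) • Y n)‖ ≤ M * Real.exp (2 * ω * s) :=
    fun n s hs => norm_exp_yosida_le hω (by have := hμ1 n; linarith) (hJ _ (hμω n)) hs
  have hmono : ∀ σ s : ℝ, σ ≤ s → M * Real.exp (2 * ω * σ) ≤ M * Real.exp (2 * ω * s) :=
    fun σ s h => by gcongr
  have hYexp' : ∀ n (s : ℝ), ∀ σ : ℝ, 0 ≤ σ → σ ≤ s →
      ‖exp ((σ : 𝕜) • Y n)‖ ≤ M * Real.exp (2 * ω * s) :=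
    fun n s σ h0 h1 => (hYexp n σ h0).trans (hmono σ s h1)
  have hμJ : ∀ z, Tendsto (fun n => ((μ n : 𝕜) • J (μ n)) z) atTop
      (𝓝 ((1 : B →L[𝕜] B) z)) := by
    have hJn : ∀ n, ‖J (μ n)‖ ≤ M * (μ n - ω)⁻¹ := fun n => by simpa using hJ _ (hμω n) 1
    refine tendsto_of_dense (K := M * 2) (fun n => ?_) hd fun x hx => ?_
    · have h0 : 0 ≤ μ n := hω.trans (hμω n).le
      rw [norm_smul, RCLike.norm_ofReal, abs_of_nonneg h0]
      calc _ ≤ μ n * (M * (μ n - ω)⁻¹) := by gcongr; exact hJn n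
        _ = M * (μ n / (μ n - ω)) := by ring
        _ ≤ M * 2 := by
            gcongr
            have := hμ1 n
            rw [div_le_iff₀ (by linarith)]; linarith
    · obtain ⟨y, hxy⟩ := LinearPMap.mem_domain_iff.1 hx
      have h1 : Tendsto (fun n => J (μ n) y) atTop (𝓝 0) := by
        refine squeeze_zero_norm (fun n => ContinuousLinearMap.le_of_opNorm_le _ (hJn n) y) ?_
        have : Tendsto (fun n => (μ n - ω)⁻¹) atTop (𝓝 0) :=
          tendsto_inv_atTop_zero.comp (tendsto_atTop_add_const_right _ (-ω) hμtop)
        simpa using (this.const_mul M).mul_const ‖y‖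
      have h2 := h1.add_const x
      rw [zero_add] at h2
      refine h2.congr fun n => ?_
      have := hJG _ (hμω n) x y hxy
      rw [map_sub, map_smul, sub_eq_iff_eq_add] at this
      rw [smul_apply, this, add_comm]
  have hYG : ∀ x y, (x, y) ∈ G.graph → Tendsto (fun n => Y n x) atTop (𝓝 y) := by
    intro x y hxy
    refine (hμJ y).congr fun n => ?_
    have := hJG _ (hμω n) x y hxy
    simp only [hY, smul_apply, sub_apply, one_apply_eq_self]
    rw [map_sub, map_smul, sub_eq_iff_eq_add] at this
    rw [this, add_sub_cancel_left]
  have hex : ∀ s : ℝ≥0, ∃ T : B →L[𝕜] B, ∀ z,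
      Tendsto (fun n => exp (((s : ℝ) : 𝕜) • Y n) z) atTop (𝓝 (T z)) := by
    intro s
    refine exists_strong_limit (fun n => hYexp n s s.2) hd fun x hx => ?_
    obtain ⟨y, hxy⟩ := LinearPMap.mem_domain_iff.1 hx
    set K := M * Real.exp (2 * ω * s) with hK
    have hK0 : 0 ≤ K := by positivity
    rw [Metric.cauchySeq_iff]
    intro ε hε
    obtain ⟨N, hN⟩ := Metric.cauchySeq_iff.1 (hYG x y hxy).cauchySeq (ε / (K * K * s + 1))
      (by positivity)
    refine ⟨N, fun m hm n hn => ?_⟩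
    have h1 := norm_exp_smul_sub_exp_smul_le (hYcomm m n) x s.2 (hYexp' m s) (hYexp' n s)
    have h2 := hN m hm n hn
    rw [dist_eq_norm, lt_div_iff₀ (by positivity)] at h2
    rw [dist_eq_norm]
    refine lt_of_le_of_lt h1 (lt_of_le_of_lt ?_ h2)
    change K * (K * _) * s ≤ _
    nlinarith [norm_nonneg (Y m x - Y n x)]
  choose T hT using hex
  have hTb : ∀ s : ℝ≥0, ‖T s‖ ≤ M * Real.exp (2 * ω * s) := fun s =>
    norm_le_of_strong (fun n => hYexp n s s.2) (hT s)
  have hTY : ∀ {x y}, (x, y) ∈ G.graph → ∀ (S s : ℝ≥0), s ≤ S → ∀ n,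
      ‖T s x - exp (((s : ℝ) : 𝕜) • Y n) x‖ ≤ M * Real.exp (2 * ω * S) *
        (M * Real.exp (2 * ω * S) * ‖y - Y n x‖) * S := by
    intro x y hxy S s hs n
    have hsS : (s : ℝ) ≤ S := by exact_mod_cast hs
    refine le_of_tendsto_of_tendsto' ((hT s x).sub_const _).norm
      (((((hYG x y hxy).sub_const _).norm.const_mul _).const_mul _).mul_const _) fun m => ?_
    refine (norm_exp_smul_sub_exp_smul_le (hYcomm m n) x s.2
      (fun σ h0 h1 => hYexp' m S σ h0 (h1.trans hsS))
      (fun σ h0 h1 => hYexp' n S σ h0 (h1.trans hsS))).trans ?_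
    gcongr
    exact hsS
  have hcont : ∀ x, Continuous fun s => T s x := by
    intro x
    rw [continuous_iff_continuousAt]
    intro s₀
    set S := s₀ + 1 with hS
    set K := M * Real.exp (2 * ω * S) with hK
    have hK0 : 0 ≤ K := by positivity
    suffices h : ContinuousOn (fun s => T s x) (Set.Iic S) from
      h.continuousAt (Iic_mem_nhds (by rw [hS]; exact lt_add_one s₀))
    refine continuousOn_of_uniform_approx_of_continuousOn fun u hu => ?_
    obtain ⟨ε, hε, hεu⟩ := Metric.mem_uniformity_dist.1 hu
    obtain ⟨x', hx', hxd⟩ := Metric.dense_iff.1 hd x (ε / (2 * (K + 1))) (by positivity)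
    obtain ⟨y', hxy'⟩ := LinearPMap.mem_domain_iff.1 hxd
    have hlim : Tendsto (fun n => K * (K * ‖y' - Y n x'‖) * S) atTop (𝓝 0) := by
      simpa using (((((hYG x' y' hxy').const_sub y').norm).const_mul K).const_mul K).mul_const
        (S : ℝ)
    obtain ⟨n, hn⟩ := (hlim.eventually_lt_const (half_pos hε)).exists
    refine ⟨fun s => exp (((s : ℝ) : 𝕜) • Y n) x', ?_, fun s hs => hεu ?_⟩
    · have : Continuous fun z : 𝕜 => exp (z • Y n) x' :=
        continuous_iff_continuousAt.2 fun z => (hasDerivAt_exp_smul_apply (Y n) x' z).continuousAt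
      exact (this.comp (RCLike.continuous_ofReal.comp NNReal.continuous_coe)).continuousOn
    · have h1 := hTY hxy' S s hs n
      have h2 : ‖T s (x - x')‖ ≤ K * ‖x - x'‖ := ContinuousLinearMap.le_of_opNorm_le _
        ((hTb s).trans (hmono s S (by exact_mod_cast hs))) _
      have h3 : ‖x - x'‖ < ε / (2 * (K + 1)) := by
        rw [Metric.mem_ball, dist_comm, dist_eq_norm] at hx'; exact hx'
      have h4 : (K + 1) * ‖x - x'‖ < ε / 2 := by
        calc _ < (K + 1) * (ε / (2 * (K + 1))) := by gcongr
          _ = ε / 2 := by field_simp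
      rw [dist_eq_norm]
      calc ‖T s x - exp (((s : ℝ) : 𝕜) • Y n) x'‖
          = ‖T s (x - x') + (T s x' - exp (((s : ℝ) : 𝕜) • Y n) x')‖ := by
            rw [map_sub]; congr 1; abel
        _ ≤ _ := norm_add_le _ _
        _ < ε := by nlinarith [norm_nonneg (x - x')]
  have h0 : T 0 = 1 := by
    ext x
    refine tendsto_nhds_unique (hT 0 x) ?_
    simp
  have hadd : ∀ l m, T (l + m) = T l * T m := by
    intro l m
    let _ : NormedAlgebra ℚ (B →L[𝕜] B) := NormedAlgebra.restrictScalars ℚ 𝕜 _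
    ext x
    refine tendsto_nhds_unique (hT (l + m) x) ?_
    refine (tendsto_apply_of_strong (fun n => hYexp n l l.2) (hT l) (hT m x)).congr fun n => ?_
    rw [← mul_apply_eq_comp, ← exp_add_of_commute
      (((Commute.refl (Y n)).smul_left _).smul_right _), ← add_smul]
    push_cast
    rfl
  have hsg : IsC0Semigroup T := IsC0Semigroup.of_uniform_bound h0 hadd hTb hcont
  have hder : ∀ x y, (x, y) ∈ G.graph →
      Tendsto (fun h : ℝ≥0 => (((h : ℝ) : 𝕜))⁻¹ • (T h x - T 0 x)) (𝓝[>] 0) (𝓝 y) := by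
    intro x y hxy
    set K := M * Real.exp (2 * ω * (1 : ℝ)) with hK
    have hK0 : 0 ≤ K := by positivity
    have hest : ∀ w w', (w, w') ∈ G.graph → ∀ s : ℝ≥0, s ≤ 1 →
        ‖T s x - x - ((s : ℝ) : 𝕜) • y‖ ≤ (K * ‖y - w‖ + K * ‖w'‖ * s + ‖w - y‖) * s := by
      intro w w' hw s hs
      have hs1 : (s : ℝ) ≤ 1 := by exact_mod_cast hs
      refine le_of_tendsto_of_tendsto' (((hT s x).sub_const x).sub_const _).norm
        ((((((hYG x y hxy).sub_const w).norm.const_mul K).add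
          (((hYG w w' hw).norm.const_mul K).mul_const (s : ℝ))).add_const ‖w - y‖).mul_const
            (s : ℝ)) fun n => ?_
      refine norm_exp_smul_apply_sub_le (Y n) x y s.2 fun σ hσ0 hσs => ?_
      have hb := hYexp' n 1
      have h1 : ‖exp ((σ : 𝕜) • Y n) (Y n x - w)‖ ≤ K * ‖Y n x - w‖ :=
        ContinuousLinearMap.le_of_opNorm_le _ (hb σ hσ0 (hσs.trans hs1)) _
      have h2 : ‖exp ((σ : 𝕜) • Y n) w - w‖ ≤ K * ‖Y n w‖ * σ := by
        have := norm_exp_smul_apply_sub_le (Y n) w 0 (C := K * ‖Y n w‖) hσ0 fun ρ h0 h1 => by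
          rw [sub_zero]
          exact ContinuousLinearMap.le_of_opNorm_le _ (hb ρ h0 (h1.trans (hσs.trans hs1))) _
        simpa using this
      have e : exp ((σ : 𝕜) • Y n) (Y n x) - y = exp ((σ : 𝕜) • Y n) (Y n x - w)
          + (exp ((σ : 𝕜) • Y n) w - w) + (w - y) := by
        rw [map_sub]; abel
      rw [e]
      refine (norm_add_le _ _).trans (add_le_add ((norm_add_le _ _).trans (add_le_add h1
        (h2.trans ?_))) le_rfl)
      gcongr
    rw [Metric.tendsto_nhds]
    intro ε hε
    obtain ⟨w, hw, hwd⟩ := Metric.dense_iff.1 hd y (ε / (2 * (K + 1))) (by positivity)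
    obtain ⟨w', hww'⟩ := LinearPMap.mem_domain_iff.1 hwd
    have hsmall : Tendsto (fun h : ℝ≥0 => K * ‖w'‖ * (h : ℝ)) (𝓝 0) (𝓝 0) := by
      have : Continuous fun h : ℝ≥0 => K * ‖w'‖ * (h : ℝ) := by fun_prop
      simpa using this.tendsto 0
    filter_upwards [self_mem_nhdsWithin,
      nhdsWithin_le_nhds (hsmall.eventually_lt_const (half_pos hε)),
      nhdsWithin_le_nhds (Iic_mem_nhds (zero_lt_one : (0 : ℝ≥0) < 1))] with s hs hs2 hs1
    have hs0 : (0 : ℝ) < s := hs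
    have h𝕜 : ((s : ℝ) : 𝕜) ≠ 0 := by exact_mod_cast hs0.ne'
    have h3 : ‖y - w‖ < ε / (2 * (K + 1)) := by
      rw [Metric.mem_ball, dist_comm, dist_eq_norm] at hw; exact hw
    have h4 : (K + 1) * ‖y - w‖ < ε / 2 := by
      calc _ < (K + 1) * (ε / (2 * (K + 1))) := by gcongr
        _ = ε / 2 := by field_simp
    have h5 := hest w w' hww' s hs1
    rw [norm_sub_rev w y] at h5
    have e : (((s : ℝ) : 𝕜))⁻¹ • (T s x - T 0 x) - y
        = (((s : ℝ) : 𝕜))⁻¹ • (T s x - x - ((s : ℝ) : 𝕜) • y) := by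
      rw [h0, one_apply_eq_self, smul_sub _ _ (((s : ℝ) : 𝕜) • y), smul_smul,
        inv_mul_cancel₀ h𝕜, one_smul]
    rw [dist_eq_norm, e, norm_smul, norm_inv, RCLike.norm_ofReal, abs_of_pos hs0, inv_mul_eq_div,
      div_lt_iff₀ hs0]
    refine lt_of_le_of_lt h5 (mul_lt_mul_of_pos_right ?_ hs0)
    linarith
  refine ⟨T, hsg, fun x y => ⟨hder x y, fun hxy => ?_⟩⟩
  set r : ℝ := 2 * ω + 1 with hr
  have hωr : ω < r := by rw [hr]; linarith
  set z := (r : 𝕜) • x - y with hz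
  have hx₀ := hGJ r hωr z
  have hsub := hxy.sub (hder _ _ hx₀)
  have hu : Tendsto (fun h : ℝ≥0 => (((h : ℝ) : 𝕜))⁻¹ • (T h (x - J r z) - T 0 (x - J r z)))
      (𝓝[>] 0) (𝓝 ((r : 𝕜) • (x - J r z))) := by
    have e : y - ((r : 𝕜) • J r z - z) = (r : 𝕜) • (x - J r z) := by
      rw [hz, smul_sub]; abel
    rw [e] at hsub
    refine hsub.congr fun h => ?_
    rw [← smul_sub, map_sub (T h), map_sub (T 0)]
    congr 1
    abel
  have hzero : x - J r z = 0 := by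
    refine SeparatingDual.eq_zero_of_forall_dual_eq_zero (R := 𝕜) fun φ => ?_
    refine hsg.dual_eq_zero_of_eigen (r := r) (by rw [hr]; linarith) hTb φ hu fun s => ?_
    rw [map_smul, map_smul, smul_eq_mul]
  have hxJ := sub_eq_zero.1 hzero
  rw [← hxJ] at hx₀
  have e2 : (r : 𝕜) • x - z = y := by rw [hz]; abel
  rwa [e2] at hx₀

end HilleYosida

section Trotter

variable {𝕜 B : Type*} [RCLike 𝕜] [NormedAddCommGroup B] [NormedSpace 𝕜 B]
  {C D : B →ₗ.[𝕜] B} {expC expD : ℝ≥0 → B →L[𝕜] B}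

theorem LinearPMap.mem_add_graph_iff {x y : B} : (x, y) ∈ (C + D).graph ↔
    ∃ y₁ y₂, (x, y₁) ∈ C.graph ∧ (x, y₂) ∈ D.graph ∧ y = y₁ + y₂ := by
  constructor
  · intro h
    obtain ⟨x', hx, hy⟩ := (LinearPMap.mem_graph_iff _).1 h
    have hx' : (x' : B) ∈ C.domain ⊓ D.domain := x'.2
    refine ⟨C ⟨x', hx'.1⟩, D ⟨x', hx'.2⟩, ?_, ?_, ?_⟩
    · simp only at hx; rw [← hx]; exact C.mem_graph ⟨x', hx'.1⟩
    · simp only at hx; rw [← hx]; exact D.mem_graph ⟨x', hx'.2⟩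
    · simp only at hy; rw [← hy]; rfl
  · rintro ⟨y₁, y₂, h₁, h₂, rfl⟩
    obtain ⟨x₁, hx₁, hy₁⟩ := (LinearPMap.mem_graph_iff _).1 h₁
    obtain ⟨x₂, hx₂, hy₂⟩ := (LinearPMap.mem_graph_iff _).1 h₂
    simp only at hx₁ hy₁ hx₂ hy₂
    have hC : x ∈ C.domain := hx₁ ▸ x₁.2
    have hD : x ∈ D.domain := hx₂ ▸ x₂.2
    have e₁ : x₁ = ⟨x, hC⟩ := Subtype.ext hx₁
    have e₂ : x₂ = ⟨x, hD⟩ := Subtype.ext hx₂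
    rw [← hy₁, ← hy₂, e₁, e₂]
    exact (C + D).mem_graph ⟨x, hC, hD⟩

theorem TrotterStable.exists_pow_le (h : TrotterStable expC expD) :
    ∃ M ω δ : ℝ, 0 ≤ ω ∧ 0 < δ ∧ ∀ τ : ℝ≥0, 0 < τ → (τ : ℝ) ≤ δ → ∀ k : ℕ,
      ‖trotterStep expC expD τ ^ k‖ ≤ M * (1 + ω * τ) ^ k := by
  obtain ⟨a, M, hM, hst⟩ := h
  have hb1 : 1 ≤ max a 1 := le_max_right _ _
  have hb0 : 0 < max a 1 := by linarith
  refine ⟨M, 2 * max a 1, 1 / (2 * max a 1), by positivity, by positivity, fun τ hτ hτδ k => ?_⟩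
  have h1 := hst 1 k le_rfl τ hτ
  simp only [Nat.cast_one, div_one] at h1
  refine h1.trans (mul_le_mul_of_nonneg_left ?_ (by linarith))
  have hx0 : 0 ≤ max a 1 * τ := by positivity
  have hx1 : max a 1 * τ ≤ 1 / 2 := by
    rw [le_div_iff₀ (by positivity)] at hτδ; linarith
  have hexp : Real.exp (max a 1 * τ) ≤ 1 + 2 * max a 1 * τ := by
    refine (Real.exp_bound_div_one_sub_of_interval hx0 (by linarith)).trans ?_
    rw [div_le_iff₀ (by linarith)]
    nlinarith
  calc Real.exp (a * τ * k) ≤ Real.exp (k * (max a 1 * τ)) := by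
        rw [mul_comm (k : ℝ)]
        gcongr
        exact le_max_left _ _
    _ = Real.exp (max a 1 * τ) ^ k := Real.exp_nat_mul _ _
    _ ≤ _ := by gcongr

theorem tendsto_diffQuot_trotterStep (hC : IsC0Generator C expC) (hD : IsC0Generator D expD)
    {τ : ℕ → ℝ≥0} (hτ : Tendsto τ atTop (𝓝[>] 0)) {K : ℝ} (hK : ∀ n, ‖expC (τ n)‖ ≤ K)
    {x y : B} (hxy : (x, y) ∈ (C + D).graph) :
    Tendsto (fun n => diffQuot (trotterStep expC expD (τ n)) (τ n) x) atTop (𝓝 y) := by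
  obtain ⟨y₁, y₂, h₁, h₂, rfl⟩ := LinearPMap.mem_add_graph_iff.1 hxy
  have hc := ((hC.2 _ _).1 h₁).comp hτ
  have hd := ((hD.2 _ _).1 h₂).comp hτ
  have hstr : ∀ z, Tendsto (fun n => expC (τ n) z) atTop (𝓝 ((1 : B →L[𝕜] B) z)) := fun z => by
    have := ((hC.1.strongly_continuous z).tendsto 0).comp (hτ.mono_right nhdsWithin_le_nhds)
    rwa [hC.1.map_zero] at this
  refine (hc.add (tendsto_apply_of_strong hK hstr hd)).congr fun n => ?_
  simp only [Function.comp_apply, hC.1.map_zero, hD.1.map_zero, one_apply_eq_self, diffQuot_apply,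
    trotterStep, mul_apply_eq_comp, map_smul, map_sub]
  rw [← smul_add]
  congr 1
  abel

theorem tendsto_dual_diffQuot_trotterStep (hC : IsC0Generator C expC) (hD : IsC0Generator D expD)
    (hCd : Dense (C.domain : Set B)) (hDd : Dense (D.domain : Set B))
    (hCa : Dense (dualAdjointDomain C)) (hDa : Dense (dualAdjointDomain D))
    {τ : ℕ → ℝ≥0} (hτ : Tendsto τ atTop (𝓝[>] 0)) {K : ℝ} (hK : ∀ n, ‖expD (τ n)‖ ≤ K)
    {φ : StrongDual 𝕜 B} (hφ : φ ∈ dualAdjointDomain C ∩ dualAdjointDomain D) :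
    ∃ ψ : StrongDual 𝕜 B, (∀ x y, (x, y) ∈ (C + D).graph → φ y = ψ x) ∧
      Tendsto (fun n => φ.comp (diffQuot (trotterStep expC expD (τ n)) (τ n))) atTop (𝓝 ψ) := by
  obtain ⟨ψ₁, h₁⟩ := mem_dualAdjointDomain_iff.1 hφ.1
  obtain ⟨ψ₂, h₂⟩ := mem_dualAdjointDomain_iff.1 hφ.2
  refine ⟨ψ₁ + ψ₂, fun x y hxy => ?_, ?_⟩
  · obtain ⟨y₁, y₂, hy₁, hy₂, rfl⟩ := LinearPMap.mem_add_graph_iff.1 hxy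
    rw [map_add, h₁ _ _ hy₁, h₂ _ _ hy₂]; rfl
  · have hc := (hC.tendsto_dual_slope hCd hCa h₁).comp hτ
    have hd := (hD.tendsto_dual_slope hDd hDa h₂).comp hτ
    have hd' := (hD.tendsto_dual_comp hDd hDa ψ₁).comp (hτ.mono_right nhdsWithin_le_nhds)
    set η : ℕ → StrongDual 𝕜 B := fun n =>
      (((τ n : ℝ≥0) : ℝ) : 𝕜)⁻¹ • (φ.comp (expC (τ n)) - φ) with hη
    have hc' : Tendsto (fun n => (η n - ψ₁).comp (expD (τ n))) atTop (𝓝 0) := by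
      refine squeeze_zero_norm (a := fun n => ‖η n - ψ₁‖ * K) (fun n => ?_) ?_
      · exact (ContinuousLinearMap.opNorm_comp_le _ _).trans
          (mul_le_mul_of_nonneg_left (hK n) (norm_nonneg _))
      · have := (tendsto_iff_norm_sub_tendsto_zero.1 hc).mul_const K
        rw [zero_mul] at this
        exact this
    have := (hc'.add hd').add hd
    rw [zero_add] at this
    refine this.congr fun n => ?_
    ext x
    simp only [hη, Function.comp_apply, add_apply, sub_apply, smul_apply,
      ContinuousLinearMap.comp_apply, diffQuot_apply, trotterStep, mul_apply_eq_comp, map_smul,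
      map_sub, smul_eq_mul]
    ring

theorem isClosable_of_dense_adjoint {Z : B →ₗ.[𝕜] B} {Φ : Set (StrongDual 𝕜 B)} (hΦ : Dense Φ)
    (h : ∀ φ ∈ Φ, ∃ ψ : StrongDual 𝕜 B, ∀ x y, (x, y) ∈ Z.graph → φ y = ψ x) :
    Z.IsClosable := by
  refine ⟨Z.graph.topologicalClosure.toLinearPMap,
    (Submodule.toLinearPMap_graph_eq _ fun p hp hp0 => ?_).symm⟩
  have h0 : ∀ φ ∈ Φ, φ p.2 = 0 := fun φ hφ => by
    obtain ⟨ψ, hψ⟩ := h φ hφ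
    have hcl : IsClosed {q : B × B | φ q.2 = ψ q.1} := isClosed_eq (by fun_prop) (by fun_prop)
    have hsub : (Z.graph : Set (B × B)) ⊆ {q : B × B | φ q.2 = ψ q.1} := fun q hq =>
      hψ q.1 q.2 hq
    have : φ p.2 = ψ p.1 := closure_minimal hsub hcl hp
    rw [this, hp0, map_zero]
  refine SeparatingDual.eq_zero_of_forall_dual_eq_zero (R := 𝕜) fun χ => ?_
  exact tendsto_nhds_unique tendsto_const_nhds
    (dual_tendsto_zero_of_dense (w := fun _ => p.2) (K := ‖p.2‖) (fun _ => le_rfl) hΦ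
      (fun φ hφ => by rw [h0 φ hφ]; exact tendsto_const_nhds) χ)

/-- For a generator with core `Z`, the range of `r - Z` is dense for large `r`. -/
theorem IsC0Generator.dense_range {Z : B →ₗ.[𝕜] B} (hcl : Z.IsClosable)
    {T : ℝ≥0 → B →L[𝕜] B} (hT : IsC0Generator Z.closure T) (hd : Dense (Z.domain : Set B))
    {M a r : ℝ} (har : a < r) (hM : ∀ s : ℝ≥0, ‖T s‖ ≤ M * Real.exp (a * s)) :
    Dense {z : B | ∃ x y, (x, y) ∈ Z.graph ∧ z = (r : 𝕜) • x - y} := by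
  refine dense_graphRange Z.graph r fun χ hχ => ?_
  have hχ' : ∀ x y, (x, y) ∈ Z.closure.graph → χ y = (r : 𝕜) * χ x := fun x y hxy => by
    rw [← hcl.graph_closure_eq_closure_graph] at hxy
    have hc : IsClosed {q : B × B | χ q.2 = (r : 𝕜) * χ q.1} :=
      isClosed_eq (by fun_prop) (by fun_prop)
    have hsub : (Z.graph : Set (B × B)) ⊆ {q : B × B | χ q.2 = (r : 𝕜) * χ q.1} := fun q hq =>
      hχ q.1 q.2 hq
    exact closure_minimal hsub hc hxy
  have h0 : ∀ x ∈ Z.domain, χ x = 0 := fun x hx => by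
    obtain ⟨y, hxy⟩ := LinearPMap.mem_domain_iff.1 hx
    have hxy' := LinearPMap.le_graph_of_le Z.le_closure hxy
    exact hT.1.dual_eq_zero_of_eigen har hM χ ((hT.2 _ _).1 hxy')
      fun s => hχ' _ _ (hT.map_mem_graph hxy' s)
  ext x
  exact isClosed_property hd.denseRange_val (isClosed_eq χ.continuous continuous_const)
    (fun f : Z.domain => h0 f f.2) x

variable [CompleteSpace B]

theorem tendsto_trotterStep_pow_of_le (hC : IsC0Generator C expC) (hD : IsC0Generator D expD)
    (hdom : Dense ((C + D).domain : Set B)) (hcl : (C + D).IsClosable) {T : ℝ≥0 → B →L[𝕜] B}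
    (hT : IsC0Generator (C + D).closure T) {M ω δ : ℝ} (hω : 0 ≤ ω)
    (hst : ∀ τ : ℝ≥0, 0 < τ → (τ : ℝ) ≤ δ → ∀ k : ℕ,
      ‖trotterStep expC expD τ ^ k‖ ≤ M * (1 + ω * τ) ^ k)
    {τ : ℕ → ℝ≥0} (hτ : Tendsto τ atTop (𝓝[>] 0)) (hτ0 : ∀ n, 0 < τ n) (hτδ : ∀ n, (τ n : ℝ) ≤ δ)
    {k : ℕ → ℕ} {s : ℝ≥0} (hk : Tendsto (fun n => k n * τ n) atTop (𝓝 s)) (f : B) :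
    Tendsto (fun n => (trotterStep expC expD (τ n) ^ k n) f) atTop (𝓝 (T s f)) := by
  obtain ⟨M', a, -, hM'⟩ := hT.1.exp_bound
  set r := max ω a + 1 with hr
  have hωr : ω < r := by have := le_max_left ω a; linarith
  have har : a < r := by have := le_max_right ω a; linarith
  obtain ⟨K, -, hK⟩ := hC.1.exists_norm_le δ.toNNReal
  have hKn : ∀ n, ‖expC (τ n)‖ ≤ K := fun n => hK _ (NNReal.le_toNNReal_of_coe_le (hτδ n))
  have hτr : Tendsto (fun n => (τ n : ℝ)) atTop (𝓝 0) := by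
    have := hτ.mono_right nhdsWithin_le_nhds
    rw [← NNReal.tendsto_coe] at this; exact this
  have hL : ∀ n j, ‖trotterStep expC expD (τ n) ^ j‖ ≤ M * (1 + ω * (τ n : ℝ)) ^ j := fun n j =>
    hst _ (hτ0 n) (hτδ n) j
  have hpos : ∀ n, (0 : ℝ) < τ n := fun n => hτ0 n
  choose R hR using fun n => exists_resolvent_diffQuot (hpos n) hω hωr (hL n)
  obtain ⟨J, hJ, hJG, hGJ, -⟩ := exists_limit_resolvent hpos hω hωr hL (C + D).graph
    (fun x y hxy => tendsto_diffQuot_trotterStep hC hD hτ hKn hxy)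
    (hT.dense_range hcl hdom har hM') hR
  rw [hcl.graph_closure_eq_closure_graph] at hJG hGJ
  refine hT.tendsto_pow_apply (hdom.mono (C + D).le_closure.1) hpos hτr hω hωr hL hR hJ hJG hGJ
    ?_ f
  rw [← NNReal.tendsto_coe] at hk
  exact hk

/-- The Trotter product formula when the closure of the sum is a generator. -/
theorem tendsto_trotterStep_pow (hC : IsC0Generator C expC) (hD : IsC0Generator D expD)
    (hdom : Dense ((C + D).domain : Set B)) (hcl : (C + D).IsClosable) {T : ℝ≥0 → B →L[𝕜] B}
    (hT : IsC0Generator (C + D).closure T) (hstab : TrotterStable expC expD)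
    {τ : ℕ → ℝ≥0} (hτ : Tendsto τ atTop (𝓝[>] 0))
    {k : ℕ → ℕ} {s : ℝ≥0} (hk : Tendsto (fun n => k n * τ n) atTop (𝓝 s)) (f : B) :
    Tendsto (fun n => (trotterStep expC expD (τ n) ^ k n) f) atTop (𝓝 (T s f)) := by
  obtain ⟨M, ω, δ, hω, hδ, hst⟩ := hstab.exists_pow_le
  have hev : ∀ᶠ n in atTop, 0 < τ n ∧ (τ n : ℝ) ≤ δ := by
    have h1 : ∀ᶠ x : ℝ≥0 in 𝓝[>] 0, 0 < x ∧ (x : ℝ) ≤ δ := by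
      filter_upwards [self_mem_nhdsWithin,
        nhdsWithin_le_nhds (Iic_mem_nhds (Real.toNNReal_pos.2 hδ))] with x hx hx'
      exact ⟨hx, (Real.le_toNNReal_iff_coe_le hδ.le).1 hx'⟩
    exact hτ.eventually h1
  obtain ⟨N, hN⟩ := eventually_atTop.1 hev
  rw [← tendsto_add_atTop_iff_nat N]
  exact tendsto_trotterStep_pow_of_le hC hD hdom hcl hT hω hst
    (hτ.comp (tendsto_add_atTop_nat N)) (fun n => (hN _ (Nat.le_add_left _ _)).1)
    (fun n => (hN _ (Nat.le_add_left _ _)).2) (hk.comp (tendsto_add_atTop_nat N)) f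

theorem tendsto_div_nat_nhdsGT {t : ℝ≥0} (ht : 0 < t) :
    Tendsto (fun n : ℕ => t / n) atTop (𝓝[>] 0) := by
  refine tendsto_nhdsWithin_iff.2 ⟨?_, ?_⟩
  · rw [← NNReal.tendsto_coe]
    simpa using tendsto_const_div_atTop_nhds_zero_nat (t : ℝ)
  · filter_upwards [eventually_gt_atTop 0] with n hn
    have : (0 : ℝ≥0) < n := by exact_mod_cast hn
    exact div_pos ht this

theorem NNReal.floor_coe_real (x : ℝ≥0) : ⌊(x : ℝ)⌋₊ = ⌊x⌋₊ := by
  rw [Nat.floor_eq_iff x.coe_nonneg]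
  exact ⟨by exact_mod_cast Nat.floor_le (zero_le (a := x)),
    by exact_mod_cast Nat.lt_floor_add_one x⟩

theorem tendsto_floor_mul_div (s t : ℝ≥0) :
    Tendsto (fun n : ℕ => (⌊(n : ℝ≥0) * s⌋₊ : ℝ≥0) * (t / n)) atTop (𝓝 (t * s)) := by
  rw [← NNReal.tendsto_coe]
  have h1 : Tendsto (fun n : ℕ => (⌊(s : ℝ) * n⌋₊ : ℝ) / n) atTop (𝓝 (s : ℝ)) :=
    (tendsto_nat_floor_mul_div_atTop s.2).comp tendsto_natCast_atTop_atTop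
  rw [NNReal.coe_mul]
  refine (h1.const_mul (t : ℝ)).congr fun n => ?_
  rw [mul_comm (s : ℝ), ← NNReal.coe_natCast n, ← NNReal.coe_mul, NNReal.floor_coe_real]
  push_cast
  ring

theorem boundedApproximation_of_generator (hC : IsC0Generator C expC) (hD : IsC0Generator D expD)
    (hdom : Dense ((C + D).domain : Set B)) (hcl : (C + D).IsClosable) {T : ℝ≥0 → B →L[𝕜] B}
    (hT : IsC0Generator (C + D).closure T) (hstab : TrotterStable expC expD) {t : ℝ≥0}
    (ht : 0 < t) : BoundedApproximation (C + D) (trotterStep expC expD) t := by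
  refine ⟨(C + D).domain, le_rfl, hdom, fun f hf s => ?_⟩
  obtain ⟨g, hfg⟩ := LinearPMap.mem_domain_iff.1 hf
  have hmem := hT.map_mem_graph (LinearPMap.le_graph_of_le (C + D).le_closure hfg) (t * s)
  rw [← hcl.graph_closure_eq_closure_graph] at hmem
  obtain ⟨p, hp, hplim⟩ := mem_closure_iff_seq_limit.1 hmem
  choose u hu1 hu2 using fun n => (LinearPMap.mem_graph_iff _).1 (hp n)
  refine ⟨u, ?_, ?_⟩
  · have hk := tendsto_floor_mul_div s t
    have h1 := tendsto_trotterStep_pow hC hD hdom hcl hT hstab (tendsto_div_nat_nhdsGT ht) hk f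
    have h2 := h1.sub ((continuous_fst.tendsto _).comp hplim)
    rw [sub_self] at h2
    have h3 := h2.norm
    rw [norm_zero] at h3
    refine h3.congr fun n => ?_
    rw [hu1]; rfl
  · obtain ⟨K, hK⟩ := (Metric.isBounded_range_of_tendsto _
      ((continuous_snd.tendsto _).comp hplim)).exists_norm_le
    exact ⟨K, fun n => by rw [hu2]; exact hK _ ⟨n, rfl⟩⟩

theorem exists_generator_of_boundedApproximation (hC : IsC0Generator C expC)
    (hD : IsC0Generator D expD) (hdom : Dense ((C + D).domain : Set B))
    (hcl : (C + D).IsClosable) (hadj : Dense (dualAdjointDomain C ∩ dualAdjointDomain D))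
    (hstab : TrotterStable expC expD) {t : ℝ≥0} (ht : 0 < t)
    (happ : BoundedApproximation (C + D) (trotterStep expC expD) t) :
    ∃ T : ℝ≥0 → B →L[𝕜] B, IsC0Generator (C + D).closure T := by
  obtain ⟨M, ω, δ, hω, hδ, hst⟩ := hstab.exists_pow_le
  have hCd : Dense (C.domain : Set B) := hdom.mono fun x hx => hx.1
  have hDd : Dense (D.domain : Set B) := hdom.mono fun x hx => hx.2
  have hCa : Dense (dualAdjointDomain C) := hadj.mono Set.inter_subset_left
  have hDa : Dense (dualAdjointDomain D) := hadj.mono Set.inter_subset_right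
  obtain ⟨N, hN⟩ : ∃ N : ℕ, ∀ n, N ≤ n → 0 < t / n ∧ ((t / n : ℝ≥0) : ℝ) ≤ δ := by
    have h1 : ∀ᶠ x : ℝ≥0 in 𝓝[>] 0, 0 < x ∧ (x : ℝ) ≤ δ := by
      filter_upwards [self_mem_nhdsWithin,
        nhdsWithin_le_nhds (Iic_mem_nhds (Real.toNNReal_pos.2 hδ))] with x hx hx'
      exact ⟨hx, (Real.le_toNNReal_iff_coe_le hδ.le).1 hx'⟩
    exact eventually_atTop.1 ((tendsto_div_nat_nhdsGT ht).eventually h1)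
  set τ : ℕ → ℝ≥0 := fun n => t / ((n + N : ℕ) : ℝ≥0) with hτdef
  have hτ : Tendsto τ atTop (𝓝[>] 0) :=
    (tendsto_div_nat_nhdsGT ht).comp (tendsto_add_atTop_nat N)
  have hpos : ∀ n, (0 : ℝ) < τ n := fun n => (hN _ (Nat.le_add_left _ _)).1
  have hτδ : ∀ n, (τ n : ℝ) ≤ δ := fun n => (hN _ (Nat.le_add_left _ _)).2
  have hτr : Tendsto (fun n => (τ n : ℝ)) atTop (𝓝 0) := by
    have := hτ.mono_right nhdsWithin_le_nhds
    rw [← NNReal.tendsto_coe] at this; exact this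
  obtain ⟨K, -, hK⟩ := hC.1.exists_norm_le δ.toNNReal
  have hKn : ∀ n, ‖expC (τ n)‖ ≤ K := fun n => hK _ (NNReal.le_toNNReal_of_coe_le (hτδ n))
  obtain ⟨K', -, hK'⟩ := hD.1.exists_norm_le δ.toNNReal
  have hKn' : ∀ n, ‖expD (τ n)‖ ≤ K' := fun n => hK' _ (NNReal.le_toNNReal_of_coe_le (hτδ n))
  have hL : ∀ n j, ‖trotterStep expC expD (τ n) ^ j‖ ≤ M * (1 + ω * (τ n : ℝ)) ^ j := fun n j =>
    hst _ (hpos n) (hτδ n) j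
  have hΓ : ∀ x y, (x, y) ∈ (C + D).graph →
      Tendsto (fun n => diffQuot (trotterStep expC expD (τ n)) (τ n) x) atTop (𝓝 y) :=
    fun x y hxy => tendsto_diffQuot_trotterStep hC hD hτ hKn hxy
  obtain ⟨A, hAdom, hA, happ⟩ := happ
  have hrange : ∀ r : ℝ, ω < r →
      Dense {z : B | ∃ x y, (x, y) ∈ (C + D).graph ∧ z = (r : 𝕜) • x - y} := fun r hr => by
    refine dense_range_of_bounded_approx hpos hτr hω hr hL (C + D).graph hΓ hadj
      (fun φ hφ => tendsto_dual_diffQuot_trotterStep hC hD hCd hDd hCa hDa hτ hKn' hφ) hA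
      (fun f hf => LinearPMap.mem_domain_iff.1 (hAdom hf)) fun f hf σ hσ => ?_
    lift σ to ℝ≥0 using hσ
    obtain ⟨u, hu, K, hK⟩ := happ f hf (σ / t)
    refine ⟨fun n => u (n + N), fun n => (C + D) (u (n + N)), fun n => (C + D).mem_graph _,
      ⟨K, fun n => hK _⟩, ?_⟩
    rw [tendsto_zero_iff_norm_tendsto_zero]
    refine (hu.comp (tendsto_add_atTop_nat N)).congr fun n => ?_
    have e : ⌊((n + N : ℕ) : ℝ≥0) * (σ / t)⌋₊ = ⌊(σ : ℝ) / (τ n : ℝ)⌋₊ := by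
      rw [← NNReal.floor_coe_real]
      congr 1
      have hpos' : (0 : ℝ) < t := ht
      simp only [hτdef, NNReal.coe_mul, NNReal.coe_div, NNReal.coe_natCast]
      field_simp
    simp only [Function.comp_apply, e, hτdef]
  have hJex : ∀ r : ℝ, ∃ J : B →L[𝕜] B, ω < r →
      (∀ x y, (x, y) ∈ (C + D).closure.graph → J ((r : 𝕜) • x - y) = x) ∧
      (∀ z, (J z, (r : 𝕜) • J z - z) ∈ (C + D).closure.graph) ∧
      ∀ k, ‖J ^ k‖ ≤ M * ((r - ω)⁻¹) ^ k := fun r => by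
    by_cases hr : ω < r
    · choose R hR using fun n => exists_resolvent_diffQuot (hpos n) hω hr (hL n)
      obtain ⟨J, -, hJ⟩ := exists_limit_resolvent hpos hω hr hL (C + D).graph hΓ (hrange r hr) hR
      rw [hcl.graph_closure_eq_closure_graph] at hJ
      exact ⟨J, fun _ => hJ⟩
    · exact ⟨0, fun h => absurd h hr⟩
  choose J hJ using hJex
  exact exists_isC0Generator (hdom.mono (C + D).le_closure.1) hω (fun r hr => (hJ r hr).1)
    (fun r hr => (hJ r hr).2.1) fun r hr => (hJ r hr).2.2

end Trotter

/-- The geometric hypothesis `hB` on the space is not needed: density of the adjoint domains already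
makes the adjoint semigroups strongly continuous, which is what reflexivity would provide. -/
theorem mainTheorem7 {𝕜 B : Type*} [RCLike 𝕜] [NormedAddCommGroup B] [NormedSpace 𝕜 B]
    [CompleteSpace B]
    (hB : (IsReflexiveSpace 𝕜 B ∧ TopologicalSpace.SeparableSpace B) ∨ HasInnerProduct 𝕜 B)
    (t : ℝ≥0) (ht : 0 < t)
    (C D : B →ₗ.[𝕜] B) (expC expD : ℝ≥0 → B →L[𝕜] B)
    (hC : IsC0Generator C expC) (hD : IsC0Generator D expD)
    (hdom : Dense ((C.domain : Set B) ∩ (D.domain : Set B)))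
    (hadj : Dense (dualAdjointDomain C ∩ dualAdjointDomain D))
    (hstab : TrotterStable expC expD) :
    (((C + D).IsClosable ∧ ∃ T : ℝ≥0 → B →L[𝕜] B, IsC0Generator (C + D).closure T) ↔
      BoundedApproximation (C + D) (trotterStep expC expD) t) ∧
    (BoundedApproximation (C + D) (trotterStep expC expD) t →
      ∀ T : ℝ≥0 → B →L[𝕜] B, IsC0Generator (C + D).closure T →
        ∀ s : ℝ≥0, 0 < s → ∀ f : B,
          Tendsto (fun n : ℕ => (trotterStep expC expD (s / n) ^ n) f) atTop (𝓝 (T s f))) := by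
  have hdom' : Dense ((C + D).domain : Set B) := hdom
  have hcl : (C + D).IsClosable := by
    refine isClosable_of_dense_adjoint hadj fun φ hφ => ?_
    obtain ⟨ψ₁, h₁⟩ := mem_dualAdjointDomain_iff.1 hφ.1
    obtain ⟨ψ₂, h₂⟩ := mem_dualAdjointDomain_iff.1 hφ.2
    refine ⟨ψ₁ + ψ₂, fun x y hxy => ?_⟩
    obtain ⟨y₁, y₂, hy₁, hy₂, rfl⟩ := LinearPMap.mem_add_graph_iff.1 hxy
    rw [map_add, h₁ _ _ hy₁, h₂ _ _ hy₂]; rfl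
  refine ⟨⟨fun ⟨_, T, hT⟩ => boundedApproximation_of_generator hC hD hdom' hcl hT hstab ht,
    fun h => ⟨hcl, exists_generator_of_boundedApproximation hC hD hdom' hcl hadj hstab ht h⟩⟩,
    fun _ T hT s hs f => ?_⟩
  refine tendsto_trotterStep_pow hC hD hdom' hcl hT hstab (tendsto_div_nat_nhdsGT hs) ?_ f
  refine tendsto_const_nhds.congr' ?_
  filter_upwards [eventually_gt_atTop 0] with n hn
  have : (n : ℝ≥0) ≠ 0 := by exact_mod_cast hn.ne'
  field_simp
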